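/- **Setting.** A warehouse consists of $a\ge 1$ equidistant parallel aisles and $b\ge 2$ equidistant cross-aisles perpendicular to them; $L$ is the distance between the two outer aisles ($L=0$ iff $a=1$) and $W>0$ is the distance between the two outer cross-aisles. The depot is an arbitrary point of this grid; the picker moves along aisles and cross-aisles at unit speed, $d$ is the resulting shortest-path distance, and picking takes no time. Items lie at points of the aisles that are not on a cross-aisle. An instance $I$ is a finite sequence of orders, each a finite nonempty set of picking locations, with arrival times $0\le r_1\le\dots\le r_n$. Orders are picked in consecutive batches of at most $c$ orders ($c$ is the batching capacity); no order is split between batches. With a *pushcart*, each batch ends with the return of the picker to the depot, and the total completion time is the time of the last return; with a *robot*, the picker goes on from the place of the last pick of a batch, and the total completion time is the time of the last pick. The picker is at the depot at time $0$. $CIOPT(I)$ is the minimum total completion time when the whole instance is known at time $0$ and items can be picked only from the arrival time of their order on. The interventionist policy $Reopt$ computes, at each arrival time (orders that arrive at the same time are revealed together), a plan of minimum completion time for the orders that have arrived and are not yet completely picked, as if no further orders would arrive: it starts at the current position of the picker, the orders with picked items in the current cart must be completed as part of the current batch, and the free bins of the current cart can be assigned to any other available orders. It follows this plan along shortest paths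 until the next arrival time; a picker who has completed everything waits where she is. $Reopt(I)$ is the resulting total completion time. *Pcart* is the system with a pushcart and this policy, *Robot* the system with a robot and this policy. For a given system, warehouse and capacity $c$, $Reopt$ is asymptotically $\alpha$-competitive if there is a constant $const$, independent of the number and the characteristics of the orders, with $Reopt(I)\le \alpha\cdot CIOPT(I)+const$ for all instances $I$; the asymptotic competitive ratio $\sigma_{asymp.}(Reopt)$ is the infimum of all such $\alpha$. **Proposition 3.** Let $c\ge 2$. Whatever rule $Reopt$ uses to break ties between optimal plans and between shortest paths, $$\sigma_{asymp.}(Reopt)\ \ge\ 2$$ in *Pcart*, for every warehouse with at least two aisles, and in *Robot*, for every warehouse. In other words, the upper bound $2$ on the asymptotic competitive ratio is tight in these systems. -/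

import Mathlib

noncomputable section

namespace OrderPicking

/-- Points of the plane, `(horizontal coordinate, vertical coordinate)`. -/
abbrev Point := ℝ × ℝ

/-- A rectangular warehouse floor with `a ≥ 1` equidistant parallel (vertical) aisles and `b ≥ 2`
equidistant (horizontal) cross-aisles. The length `L` is the distance between the two outer aisles
(so it vanishes exactly when there is a single aisle), the width `W` is the distance between the
two outer cross-aisles. -/
structure Layout where
  a : ℕ
  b : ℕ
  L : ℝ
  W : ℝ
  one_le_a : 1 ≤ a
  two_le_b : 2 ≤ b
  L_nonneg : 0 ≤ L
  L_pos_iff : 0 < L ↔ 2 ≤ a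
  W_pos : 0 < W

namespace Layout

variable (w : Layout)

/-- The `i`-th aisle. (For a single aisle, `L = 0`, so this is the aisle at `0`.) -/
def aisle (i : Fin w.a) : Set Point :=
  {p | p.1 = (i : ℝ) * (w.L / ((w.a : ℝ) - 1)) ∧ 0 ≤ p.2 ∧ p.2 ≤ w.W}

/-- The `j`-th cross-aisle. -/
def crossAisle (j : Fin w.b) : Set Point :=
  {p | p.2 = (j : ℝ) * (w.W / ((w.b : ℝ) - 1)) ∧ 0 ≤ p.1 ∧ p.1 ≤ w.L}

/-- Aisles and cross-aisles together. -/
def corridor : Fin w.a ⊕ Fin w.b → Set Point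
  | Sum.inl i => w.aisle i
  | Sum.inr j => w.crossAisle j

/-- The points at which the picker can be. -/
def floor : Set Point := ⋃ k, w.corridor k

/-- Items are accessed from the aisles, never from the cross-aisles. -/
def pickingLocations : Set Point := (⋃ i, w.aisle i) \ ⋃ j, w.crossAisle j

/-- `w.Walk p q ℓ`: there is a walk of length `ℓ` from `p` to `q` that consists of finitely many
straight moves, each within one aisle or within one cross-aisle. -/
inductive Walk : Point → Point → ℝ → Prop
  | nil {p : Point} (hp : p ∈ w.floor) : Walk p p 0
  | cons {p q r : Point} {ℓ : ℝ} (k : Fin w.a ⊕ Fin w.b) (hp : p ∈ w.corridor k)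
      (hq : q ∈ w.corridor k) (h : Walk q r ℓ) :
      Walk p r (|p.1 - q.1| + |p.2 - q.2| + ℓ)

/-- The walking distance in the warehouse. -/
def dist (p q : Point) : ℝ := sInf {ℓ | w.Walk p q ℓ}

end Layout

/-- A warehouse: a layout with the location of the depot. -/
structure Warehouse extends Layout where
  depot : Point
  depot_mem : depot ∈ toLayout.floor

/-- The type of cart: with a pushcart every batch ends with the return of the picker to the depot;
with a robot the picker goes on from the place of the last pick of the batch. -/
inductive Cart
  | pushcart
  | robot

/-- A sequence of `n` orders, each a nonempty finite set of picking locations, with their arrival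
times. -/
structure Instance (w : Warehouse) where
  n : ℕ
  order : Fin n → Finset Point
  order_nonempty : ∀ j, (order j).Nonempty
  order_subset : ∀ j, ↑(order j) ⊆ w.pickingLocations
  arrival : Fin n → ℝ
  arrival_nonneg : ∀ j, 0 ≤ arrival j
  arrival_mono : Monotone arrival

/-- An item: the order it belongs to, and its picking location. -/
abbrev Item (n : ℕ) := Fin n × Point

/-- What a picker does at a stop: pick an item, or close the current batch. -/
inductive Action (n : ℕ)
  | pick (x : Item n)
  | close

/-- A plan: the sequence of batches, each given by the sequence in which the items that are still
to be collected for it are picked. -/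
abbrev Plan (n : ℕ) := List (List (Item n))

/-- The sequence of actions of a plan. -/
def Plan.actions {n : ℕ} (P : Plan n) : List (Action n) :=
  P.flatMap fun B => B.map Action.pick ++ [Action.close]

/-- The set of orders of the items in a list. -/
def ordersOf {n : ℕ} (B : List (Item n)) : Finset (Fin n) := (B.map Prod.fst).toFinset

/-- The sets of orders in the successive batches of a plan, when the orders in `cart` have already
been commenced: these belong to the first (the current) batch. -/
def Plan.batches {n : ℕ} (cart : Finset (Fin n)) : Plan n → List (Finset (Fin n))
  | [] => []
  | B :: P => (cart ∪ ordersOf B) :: P.map ordersOf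

/-- `P` is a feasible plan to pick the set `pending` of items with batching capacity `c`, when
the bins of the current cart hold items of the orders in `cart`: every pending item is picked
exactly once, no order is split between batches, each batch has at most `c` orders, and the
commenced orders are completed in the current batch. -/
structure Plan.Feasible {n : ℕ} (c : ℕ) (pending : Finset (Item n)) (cart : Finset (Fin n))
    (P : Plan n) : Prop where
  nodup : P.flatten.Nodup
  toFinset_eq : P.flatten.toFinset = pending
  ne_nil : cart.Nonempty → P ≠ []
  batch_nonempty : ∀ S ∈ P.batches cart, S.Nonempty
  batch_card : ∀ S ∈ P.batches cart, S.card ≤ c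
  batch_disjoint : (P.batches cart).Pairwise Disjoint

/-- Where an action takes place, if the picker is at `p` before. -/
def target {n : ℕ} (κ : Cart) (w : Warehouse) (p : Point) : Action n → Point
  | Action.pick x => x.2
  | Action.close =>
    match κ with
    | Cart.pushcart => w.depot
    | Cart.robot => p

/-- The earliest time at which an action is allowed, given the release times of the orders (and
given that it is not before time `t`). -/
def release {n : ℕ} (r : Fin n → ℝ) (t : ℝ) : Action n → ℝ
  | Action.pick x => r x.1
  | Action.close => t

/-- The time at which a picker who starts at time `t` at `p` and walks at unit speed completes a
sequence of actions, each done as early as possible; picking itself takes no time. -/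
def finishTime {n : ℕ} (κ : Cart) (w : Warehouse) (r : Fin n → ℝ) :
    ℝ → Point → List (Action n) → ℝ
  | t, _, [] => t
  | t, p, x :: l =>
    finishTime κ w r (max (t + w.dist p (target κ w p x)) (release r t x)) (target κ w p x) l

namespace Instance

variable {w : Warehouse} (I : Instance w)

/-- The items of the orders that have arrived by time `t`. -/
def arrived (t : ℝ) : Finset (Item I.n) :=
  (Finset.univ.filter fun j => I.arrival j ≤ t).biUnion fun j => (I.order j).image (Prod.mk j)

/-- All items. -/
def items : Finset (Item I.n) :=
  Finset.univ.biUnion fun j => (I.order j).image (Prod.mk j)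

/-- The complete-information optimum: the least completion time of a feasible plan for all orders,
where the picker starts at time `0` at the depot and knows the whole instance, and an item can be
picked only after the arrival of its order. -/
def ciopt (κ : Cart) (c : ℕ) : ℝ :=
  sInf {v | ∃ P : Plan I.n, P.Feasible c I.items ∅ ∧
    v = finishTime κ w I.arrival 0 w.depot P.actions}

/-- The state of the picking process: the position of the picker, the set of the items that have
been picked, and the set of the orders with picked items in the current cart. -/
structure State where
  pos : Point
  picked : Finset (Item I.n)
  cart : Finset (Fin I.n)

/-- The initial state. -/
def init : I.State := ⟨w.depot, ∅, ∅⟩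

/-- The result of an action. -/
def perform (κ : Cart) (s : I.State) : Action I.n → I.State
  | Action.pick x => ⟨x.2, insert x s.picked, insert x.1 s.cart⟩
  | Action.close => ⟨target κ w s.pos (Action.close : Action I.n), s.picked, ∅⟩

/-- `P` is an optimal plan at time `t` in state `s` for the orders that have arrived by then: it
starts at the current position, completes the commenced orders in the current batch, may fill the
remaining bins of the current cart with any other orders, and it has the least completion time. -/
def IsOptimalPlan (κ : Cart) (c : ℕ) (t : ℝ) (s : I.State) (P : Plan I.n) : Prop :=
  P.Feasible c (I.arrived t \ s.picked) s.cart ∧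
    ∀ Q : Plan I.n, Q.Feasible c (I.arrived t \ s.picked) s.cart →
      finishTime κ w I.arrival t s.pos P.actions ≤ finishTime κ w I.arrival t s.pos Q.actions

/-- `I.Exec κ s l τ s'`: if a picker in state `s` follows the sequence of actions `l` (for orders
that have arrived) for a time `τ`, walking at unit speed along shortest paths and stopping when
everything is done, then `s'` is a state that she can be in afterwards. A point `y` is on a shortest
path from `p` to `q`, at distance `τ` from `p`, if `dist p y = τ` and `dist y q = dist p q - τ`. -/
inductive Exec (κ : Cart) : I.State → List (Action I.n) → ℝ → I.State → Prop
  | idle (s : I.State) (τ : ℝ) : Exec κ s [] τ s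
  | underway (s : I.State) (x : Action I.n) (l : List (Action I.n)) (τ : ℝ) (y : Point)
      (hτ : τ < w.dist s.pos (target κ w s.pos x)) (hy : y ∈ w.floor) (h₁ : w.dist s.pos y = τ)
      (h₂ : w.dist y (target κ w s.pos x) = w.dist s.pos (target κ w s.pos x) - τ) :
      Exec κ s (x :: l) τ ⟨y, s.picked, s.cart⟩
  | step (s : I.State) (x : Action I.n) (l : List (Action I.n)) (τ : ℝ) (s' : I.State)
      (hτ : w.dist s.pos (target κ w s.pos x) ≤ τ)
      (h : Exec κ (I.perform κ s x) l (τ - w.dist s.pos (target κ w s.pos x)) s') :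
      Exec κ s (x :: l) τ s'

/-- `I.ReoptFrom κ c ts s v`: if the remaining arrival times are the members of the increasing
list `ts`, and the state at the first of them is `s`, then `v` is a possible total completion time
of (interventionist) reoptimization: at each arrival time an optimal plan is chosen, and it is
followed until the next arrival time. -/
def ReoptFrom (κ : Cart) (c : ℕ) : List ℝ → I.State → ℝ → Prop
  | [], _, v => v = 0
  | [t], s, v => ∃ P : Plan I.n, I.IsOptimalPlan κ c t s P ∧
      v = finishTime κ w I.arrival t s.pos P.actions
  | t :: t' :: ts, s, v => ∃ P : Plan I.n, I.IsOptimalPlan κ c t s P ∧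
      ∃ s' : I.State, I.Exec κ s P.actions (t' - t) s' ∧ ReoptFrom κ c (t' :: ts) s' v

/-- The distinct arrival times, in increasing order. -/
def arrivalTimes : List ℝ := (Finset.univ.image I.arrival).sort (· ≤ ·)

end Instance

/-- `R` gives the total completion times of interventionist `Reopt` (under some rule that breaks
ties between optimal plans and between shortest paths) on all instances in the warehouse `w`. -/
def IsReopt (κ : Cart) (w : Warehouse) (c : ℕ) (R : Instance w → ℝ) : Prop :=
  ∀ I : Instance w, I.ReoptFrom κ c I.arrivalTimes I.init (R I)

/-- `ALG` is asymptotically `α`-competitive, in the warehouse `w` and with batching capacity `c`: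
the additive constant does not depend on the orders. -/
def AsympCompetitive (κ : Cart) (w : Warehouse) (c : ℕ) (ALG : Instance w → ℝ) (α : ℝ) : Prop :=
  ∃ C : ℝ, ∀ I : Instance w, ALG I ≤ α * I.ciopt κ c + C

/-- The asymptotic competitive ratio: the infimum of all `α` such that `ALG` is asymptotically
`α`-competitive (`⊤` if there is none). -/
def asympRatio (κ : Cart) (w : Warehouse) (c : ℕ) (ALG : Instance w → ℝ) : EReal :=
  sInf ((fun α : ℝ => (α : EReal)) '' {α | AsympCompetitive κ w c ALG α})

end OrderPicking

/-! The definitions are meaningful: shortest walks and optimal plans exist, so that reoptimization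
can be carried out on every instance. -/

namespace OrderPicking
namespace Layout
variable {w : Layout}

theorem mem_floor {p : Point} {k} (h : p ∈ w.corridor k) : p ∈ w.floor := Set.mem_iUnion.2 ⟨k, h⟩

theorem Walk.nonneg {p q ℓ} (h : w.Walk p q ℓ) : 0 ≤ ℓ := by
  induction h with
  | nil => exact le_rfl
  | cons k hp hq h ih => positivity

theorem Walk.left_mem {p q ℓ} (h : w.Walk p q ℓ) : p ∈ w.floor := by
  cases h with
  | nil h => exact h
  | cons k h _ _ => exact mem_floor h

theorem Walk.trans {p q r ℓ m} (h : w.Walk p q ℓ) (h' : w.Walk q r m) : w.Walk p r (ℓ + m) := by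
  induction h with
  | nil => simpa using h'
  | cons k hp hq h ih => rw [add_assoc]; exact .cons k hp hq (ih h')

theorem Walk.single {p q k} (hp : p ∈ w.corridor k) (hq : q ∈ w.corridor k) :
    w.Walk p q (|p.1 - q.1| + |p.2 - q.2|) := by
  simpa using Walk.cons k hp hq (.nil (mem_floor hq))

theorem Walk.symm {p q ℓ} (h : w.Walk p q ℓ) : w.Walk q p ℓ := by
  induction h with
  | nil h => exact .nil h
  | cons k hp hq h ih =>
    have := ih.trans (Walk.single hq hp)
    rw [abs_sub_comm, abs_sub_comm (Prod.snd _)] at this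
    rwa [add_comm]

theorem zero_aisle_le (i : Fin w.a) : 0 ≤ (i : ℝ) * (w.L / ((w.a : ℝ) - 1)) ∧
    (i : ℝ) * (w.L / ((w.a : ℝ) - 1)) ≤ w.L := by
  have h1 : (1 : ℝ) ≤ w.a := by exact_mod_cast w.one_le_a
  have hi : (i : ℝ) + 1 ≤ w.a := by exact_mod_cast i.2
  have hL := w.L_nonneg
  refine ⟨mul_nonneg (by positivity) (div_nonneg hL (by linarith)), ?_⟩
  rcases eq_or_lt_of_le h1 with h | h
  · simp [← h, hL]
  · rw [← mul_div_assoc, div_le_iff₀ (by linarith)]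
    nlinarith

theorem exists_walk_zero {p : Point} (hp : p ∈ w.floor) : ∃ ℓ, w.Walk p (0, 0) ℓ := by
  have ha := w.one_le_a
  have hb := w.two_le_b
  have h0a : ∀ y, 0 ≤ y → y ≤ w.W → ((0 : ℝ), y) ∈ w.corridor (.inl ⟨0, ha⟩) := by
    intro y h1 h2; simp [corridor, aisle, h1, h2]
  obtain ⟨k, hk⟩ := Set.mem_iUnion.1 hp
  rcases k with i | j
  · have hx := zero_aisle_le i
    obtain ⟨h1, h2, h3⟩ := hk
    have hc : ∀ x, 0 ≤ x → x ≤ w.L → ((x : ℝ), (0 : ℝ)) ∈ w.corridor (.inr ⟨0, by omega⟩) := by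
      intro y h1 h2; simp [corridor, crossAisle, h1, h2]
    refine ⟨_, (Walk.single (k := .inl i) (q := (p.1, 0)) ⟨h1, h2, h3⟩ ⟨h1, le_rfl, w.W_pos.le⟩).trans
      (Walk.single (hc _ ?_ ?_) (hc 0 le_rfl w.L_nonneg))⟩
    · rw [h1]; exact hx.1
    · rw [h1]; exact hx.2
  · obtain ⟨h1, h2, h3⟩ := hk
    have hb1 : (1 : ℝ) < w.b := by exact_mod_cast hb
    have hj : (j : ℝ) + 1 ≤ w.b := by exact_mod_cast j.2
    have hW := w.W_pos
    refine ⟨_, (Walk.single (k := .inr j) (q := (0, p.2)) ⟨h1, h2, h3⟩ ⟨h1, le_rfl, w.L_nonneg⟩).trans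
      (Walk.single (h0a _ ?_ ?_) (h0a 0 le_rfl hW.le))⟩
    · rw [h1]; exact mul_nonneg (by positivity) (div_nonneg hW.le (by linarith))
    · rw [h1, ← mul_div_assoc, div_le_iff₀ (by linarith)]; nlinarith

theorem exists_walk {p q : Point} (hp : p ∈ w.floor) (hq : q ∈ w.floor) : ∃ ℓ, w.Walk p q ℓ := by
  obtain ⟨_, h⟩ := exists_walk_zero hp
  obtain ⟨_, h'⟩ := exists_walk_zero hq
  exact ⟨_, h.trans h'.symm⟩

theorem dist_le {p q ℓ} (h : w.Walk p q ℓ) : w.dist p q ≤ ℓ :=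
  csInf_le ⟨0, fun _ h => Walk.nonneg h⟩ h

theorem dist_nonneg (p q : Point) : 0 ≤ w.dist p q := Real.sInf_nonneg fun _ h => Walk.nonneg h

theorem exists_walk_lt {p q : Point} (hp : p ∈ w.floor) (hq : q ∈ w.floor) {e : ℝ}
    (he : w.dist p q < e) : ∃ ℓ < e, w.Walk p q ℓ := by
  obtain ⟨ℓ, h, h'⟩ := exists_lt_of_csInf_lt (s := {ℓ | w.Walk p q ℓ}) (exists_walk hp hq) he
  exact ⟨ℓ, h', h⟩

theorem dist_triangle {p q r : Point} (hp : p ∈ w.floor) (hq : q ∈ w.floor) (hr : r ∈ w.floor) :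
    w.dist p r ≤ w.dist p q + w.dist q r := by
  refine le_of_forall_pos_lt_add fun e he => ?_
  obtain ⟨l, h1, h2⟩ := exists_walk_lt hp hq (lt_add_of_pos_right _ (half_pos he))
  obtain ⟨m, h3, h4⟩ := exists_walk_lt hq hr (lt_add_of_pos_right _ (half_pos he))
  have := dist_le (h2.trans h4)
  linarith

theorem dist_comm (p q : Point) : w.dist p q = w.dist q p := by
  unfold dist; congr 1; ext ℓ; exact ⟨Walk.symm, Walk.symm⟩

theorem Walk.mid {p q ℓ} (h : w.Walk p q ℓ) : ∀ τ, 0 ≤ τ → τ ≤ ℓ →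
    ∃ y, w.Walk p y τ ∧ w.Walk y q (ℓ - τ) := by
  induction h with
  | nil h =>
    intro τ h1 h2
    obtain rfl : τ = 0 := le_antisymm h2 h1
    exact ⟨_, .nil h, by simpa using Walk.nil h⟩
  | @cons p q r ℓ k hp hq h ih =>
    intro τ h1 h2
    set m := |p.1 - q.1| + |p.2 - q.2| with hm
    have hm0 : 0 ≤ m := by positivity
    rcases le_or_gt τ m with hτ | hτ
    · rcases eq_or_lt_of_le hm0 with h0 | h0
      · obtain rfl : τ = 0 := le_antisymm (h0 ▸ hτ) h1
        exact ⟨p, .nil (mem_floor hp), by simpa using Walk.cons k hp hq h⟩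
      set s := τ / m with hs
      have hs0 : 0 ≤ s := by positivity
      have hs1 : s ≤ 1 := (div_le_one h0).2 hτ
      have hsm : s * m = τ := div_mul_cancel₀ _ h0.ne'
      let y : Point := (p.1 + s * (q.1 - p.1), p.2 + s * (q.2 - p.2))
      have hy : y ∈ w.corridor k := by
        rcases k with i | j
        · obtain ⟨a1, a2, a3⟩ := hp
          obtain ⟨b1, b2, b3⟩ := hq
          refine ⟨by simp only [y]; rw [b1, a1]; ring, ?_, ?_⟩ <;> simp only [y] <;> nlinarith
        · obtain ⟨a1, a2, a3⟩ := hp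
          obtain ⟨b1, b2, b3⟩ := hq
          refine ⟨by simp only [y]; rw [b1, a1]; ring, ?_, ?_⟩ <;> simp only [y] <;> nlinarith
      have e1 : |p.1 - y.1| + |p.2 - y.2| = τ := by
        have : p.1 - y.1 = s * (p.1 - q.1) := by simp only [y]; ring
        have h' : p.2 - y.2 = s * (p.2 - q.2) := by simp only [y]; ring
        rw [this, h', abs_mul, abs_mul, abs_of_nonneg hs0, ← mul_add, hsm]
      have e2 : |y.1 - q.1| + |y.2 - q.2| = m - τ := by
        have : y.1 - q.1 = (1 - s) * (p.1 - q.1) := by simp only [y]; ring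
        have h' : y.2 - q.2 = (1 - s) * (p.2 - q.2) := by simp only [y]; ring
        rw [this, h', abs_mul, abs_mul, abs_of_nonneg (sub_nonneg.2 hs1), ← mul_add, ← hm, ← hsm]
        ring
      refine ⟨y, e1 ▸ Walk.single hp hy, ?_⟩
      have := Walk.cons k hy hq h
      rw [e2] at this
      convert this using 1; ring
    · obtain ⟨y, h3, h4⟩ := ih (τ - m) (by linarith) (by linarith)
      refine ⟨y, ?_, by convert h4 using 1; ring⟩
      convert Walk.cons k hp hq h3 using 1; ring

theorem isCompact_corridor (k) : IsCompact (w.corridor k) := by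
  rcases k with i | j
  · convert (isCompact_singleton (x := (i : ℝ) * (w.L / ((w.a : ℝ) - 1)))).prod
      (isCompact_Icc (a := (0 : ℝ)) (b := w.W)) using 1
    ext p
    simp [corridor, aisle, Set.mem_prod]
  · have := (isCompact_Icc (a := (0 : ℝ)) (b := w.L)).prod
      (isCompact_singleton (x := (j : ℝ) * (w.W / ((w.b : ℝ) - 1))))
    convert this using 1
    ext p
    simp [corridor, crossAisle, Set.mem_prod, and_comm]

theorem continuousOn_dist {p : Point} (hp : p ∈ w.floor) (k) :
    ContinuousOn (fun y => w.dist p y) (w.corridor k) := by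
  have : LipschitzOnWith 2 (fun y => w.dist p y) (w.corridor k) := by
    refine LipschitzOnWith.of_le_add_mul _ fun x hx y hy => ?_
    have h1 := dist_triangle hp (mem_floor hy) (mem_floor hx)
    have h2 := dist_le (Walk.single hy hx)
    have h3 : |y.1 - x.1| ≤ Dist.dist x y := by
      rw [abs_sub_comm]; exact (le_max_left _ _)
    have h4 : |y.2 - x.2| ≤ Dist.dist x y := by
      rw [abs_sub_comm]; exact (le_max_right _ _)
    push_cast
    linarith
  exact this.continuousOn

theorem exists_between {p q : Point} (hp : p ∈ w.floor) (hq : q ∈ w.floor) {τ : ℝ} (h0 : 0 ≤ τ)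
    (hτ : τ ≤ w.dist p q) :
    ∃ y ∈ w.floor, w.dist p y = τ ∧ w.dist y q = w.dist p q - τ := by
  let F : Point → ℝ := fun y => max (w.dist p y - τ) (w.dist q y - (w.dist p q - τ))
  have hF : ContinuousOn F w.floor := by
    refine LocallyFinite.continuousOn_iUnion (locallyFinite_of_finite _)
      (fun k => (isCompact_corridor k).isClosed) fun k => ?_
    exact ContinuousOn.sup ((continuousOn_dist hp k).sub continuousOn_const)
      ((continuousOn_dist hq k).sub continuousOn_const)
  have hc : IsCompact w.floor := isCompact_iUnion isCompact_corridor
  obtain ⟨y, hy, hmin⟩ := hc.exists_isMinOn ⟨p, hp⟩ hF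
  have hy0 : F y ≤ 0 := by
    refine le_of_forall_pos_le_add fun e he => ?_
    obtain ⟨ℓ, h1, h2⟩ := exists_walk_lt hp hq (lt_add_of_pos_right _ he)
    obtain ⟨z, h3, h4⟩ := h2.mid τ h0 (hτ.trans (dist_le h2))
    have hz : z ∈ w.floor := h4.left_mem
    refine (hmin hz).trans (max_le ?_ ?_)
    · have := dist_le h3; linarith
    · have := dist_le h4.symm; linarith
  have a1 := (le_max_left _ _).trans hy0
  have a2 := (le_max_right _ _).trans hy0
  have a3 := dist_triangle hp hy hq
  have a4 := dist_comm (w := w) q y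
  rw [a4] at a2
  exact ⟨y, hy, by linarith, by linarith⟩

theorem dist_self {p : Point} (hp : p ∈ w.floor) : w.dist p p = 0 :=
  le_antisymm (dist_le (.nil hp)) (dist_nonneg _ _)

end Layout
end OrderPicking
namespace OrderPicking
open Layout

theorem feasible_exists {n : ℕ} {c : ℕ} (hc : 1 ≤ c) (S : Finset (Item n)) (cart : Finset (Fin n))
    (hcart : cart.card ≤ c) : ∃ P : Plan n, P.Feasible c S cart := by
  classical
  let G : Finset (Fin n) := (S.image Prod.fst) \ cart
  let f : Fin n → List (Item n) := fun j => (S.filter fun x => x.1 = j).toList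
  let B₀ : List (Item n) := (S.filter fun x => x.1 ∈ cart).toList
  let P₀ : Plan n := if cart.Nonempty then [B₀] else []
  have hf : ∀ j ∈ G, ordersOf (f j) = {j} := by
    intro j hj
    ext i
    simp only [G, Finset.mem_sdiff, Finset.mem_image] at hj
    obtain ⟨⟨x, hx, rfl⟩, -⟩ := hj
    simp only [ordersOf, f, List.mem_toFinset, List.mem_map, Finset.mem_toList, Finset.mem_filter,
      Finset.mem_singleton]
    constructor
    · rintro ⟨y, ⟨-, h⟩, rfl⟩; exact h
    · rintro rfl; exact ⟨x, ⟨hx, rfl⟩, rfl⟩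
  have hB : cart ∪ ordersOf B₀ = cart := by
    rw [Finset.union_eq_left]
    intro i
    simp only [ordersOf, B₀, List.mem_toFinset, List.mem_map, Finset.mem_toList, Finset.mem_filter]
    rintro ⟨y, ⟨-, h⟩, rfl⟩; exact h
  have hmem : ∀ x, x ∈ (P₀ ++ G.toList.map f).flatten ↔ x ∈ S := by
    intro x
    rw [List.flatten_append, List.mem_append]
    by_cases hx : x.1 ∈ cart
    · have : cart.Nonempty := ⟨_, hx⟩
      simp [P₀, this, B₀, hx, G, f]
    · have : x ∉ P₀.flatten := by
        by_cases h : cart.Nonempty <;> simp [P₀, h, B₀, hx]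
      simp only [this, false_or]
      simp only [List.mem_flatten, List.mem_map, Finset.mem_toList]
      constructor
      · rintro ⟨_, ⟨j, hj, rfl⟩, h⟩
        simp only [f, Finset.mem_toList, Finset.mem_filter] at h
        exact h.1
      · intro h
        exact ⟨_, ⟨x.1, by simp only [G, Finset.mem_sdiff, Finset.mem_image]; exact ⟨⟨x, h, rfl⟩, hx⟩,
          rfl⟩, by simp [f, h]⟩
  have hbat : Plan.batches cart (P₀ ++ G.toList.map f) =
      (if cart.Nonempty then [cart] else []) ++ G.toList.map fun j => {j} := by
    have hm : (G.toList.map f).map ordersOf = G.toList.map fun j => {j} := by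
      rw [List.map_map]
      exact List.map_congr_left fun j hj => hf j (Finset.mem_toList.1 hj)
    by_cases h : cart.Nonempty
    · simp only [P₀, h, if_true, List.singleton_append, Plan.batches, hB, hm]
    · have h' : cart = ∅ := Finset.not_nonempty_iff_eq_empty.1 h
      simp only [P₀, h, if_false, List.nil_append]
      rw [← hm]
      cases G.toList.map f with
      | nil => rfl
      | cons a l => simp [Plan.batches, h']
  refine ⟨P₀ ++ G.toList.map f, ?_, ?_, ?_, ?_, ?_, ?_⟩
  · rw [List.flatten_append, List.nodup_append']
    refine ⟨?_, ?_, ?_⟩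
    · by_cases h : cart.Nonempty <;> simp [P₀, h, B₀, Finset.nodup_toList]
    · rw [List.nodup_flatten]
      refine ⟨?_, ?_⟩
      · intro l hl
        obtain ⟨j, -, rfl⟩ := List.mem_map.1 hl
        exact Finset.nodup_toList _
      · rw [List.pairwise_map]
        refine (Finset.nodup_toList G).imp ?_
        intro i j hij x hx hx'
        simp only [f, Finset.mem_toList, Finset.mem_filter] at hx hx'
        exact hij (hx.2.symm.trans hx'.2)
    · intro x hx hx'
      have h1 : x.1 ∈ cart := by
        by_cases h : cart.Nonempty <;> simp [P₀, h, B₀] at hx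
        exact hx.2
      simp only [List.mem_flatten, List.mem_map, Finset.mem_toList] at hx'
      obtain ⟨_, ⟨j, hj, rfl⟩, h⟩ := hx'
      simp only [f, Finset.mem_toList, Finset.mem_filter] at h
      rw [h.2] at h1
      exact (Finset.mem_sdiff.1 hj).2 h1
  · ext x; rw [List.mem_toFinset]; exact hmem x
  · intro h; simp [P₀, h]
  · rw [hbat]
    intro T hT
    rw [List.mem_append] at hT
    rcases hT with hT | hT
    · by_cases h : cart.Nonempty <;> simp [h] at hT
      rwa [hT]
    · obtain ⟨j, -, rfl⟩ := List.mem_map.1 hT; simp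
  · rw [hbat]
    intro T hT
    rw [List.mem_append] at hT
    rcases hT with hT | hT
    · by_cases h : cart.Nonempty <;> simp [h] at hT
      rwa [hT]
    · obtain ⟨j, -, rfl⟩ := List.mem_map.1 hT; simpa
  · rw [hbat, List.pairwise_append]
    refine ⟨?_, ?_, ?_⟩
    · by_cases h : cart.Nonempty <;> simp [h]
    · rw [List.pairwise_map]
      refine (Finset.nodup_toList G).imp ?_
      intro i j hij; simpa using hij
    · intro T hT U hU
      by_cases h : cart.Nonempty <;> simp [h] at hT
      subst hT
      obtain ⟨j, hj, rfl⟩ := List.mem_map.1 hU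
      rw [Finset.mem_toList, Finset.mem_sdiff] at hj
      simpa using hj.2

theorem finite_lists {α : Type*} {s : Set α} (hs : s.Finite) (N : ℕ) :
    {l : List α | (∀ x ∈ l, x ∈ s) ∧ l.length ≤ N}.Finite := by
  have := hs.to_subtype
  refine ((List.finite_length_le s N).image (List.map Subtype.val)).subset ?_
  rintro l ⟨h1, h2⟩
  lift l to List s using h1
  exact ⟨l, by simpa using h2, rfl⟩

theorem finite_feasible {n : ℕ} (c : ℕ) (S : Finset (Item n)) (cart : Finset (Fin n)) :
    {P : Plan n | P.Feasible c S cart}.Finite := by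
  classical
  refine (finite_lists (finite_lists S.finite_toSet S.card) (S.card + 1)).subset ?_
  intro P hP
  have hlen : P.flatten.length = S.card := by
    rw [← hP.toFinset_eq, List.toFinset_card_of_nodup hP.nodup]
  have hsum : ∀ B ∈ P, B.length ≤ S.card := by
    intro B hB
    rw [← hlen]
    exact (List.sublist_flatten_of_mem hB).length_le
  refine ⟨fun B hB => ⟨fun x hx => ?_, hsum B hB⟩, ?_⟩
  · rw [Finset.mem_coe, ← hP.toFinset_eq, List.mem_toFinset]
    exact List.mem_flatten_of_mem hB hx
  · have key : ∀ Q : Plan n, (∀ B ∈ Q, B ≠ []) → Q.length ≤ Q.flatten.length := by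
      intro Q hQ
      induction Q with
      | nil => simp
      | cons B Q ih =>
        have h1 := ih fun B hB => hQ B (List.mem_cons_of_mem _ hB)
        have h2 := List.length_pos_iff.2 (hQ B List.mem_cons_self)
        simp only [List.flatten_cons, List.length_append, List.length_cons]
        omega
    cases P with
    | nil => simp
    | cons B Q =>
      have := key Q fun B' hB' h => by
        have := hP.batch_nonempty (ordersOf B') (by
          simp only [Plan.batches, List.mem_cons, List.mem_map]
          exact Or.inr ⟨B', hB', rfl⟩)
        simp [h, ordersOf] at this
      simp only [List.flatten_cons, List.length_append] at hlen
      simp only [List.length_cons]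
      omega

variable {w : Warehouse} (I : Instance w)

theorem Instance.exists_optimal (κ : Cart) {c : ℕ} (hc : 1 ≤ c) (t : ℝ) (s : I.State)
    (hs : s.cart.card ≤ c) : ∃ P, I.IsOptimalPlan κ c t s P := by
  obtain ⟨P, h1, h2⟩ := Set.exists_min_image _
    (fun P : Plan I.n => finishTime κ w I.arrival t s.pos P.actions)
    (finite_feasible c (I.arrived t \ s.picked) s.cart)
    (feasible_exists hc (I.arrived t \ s.picked) s.cart hs)
  exact ⟨P, h1, h2⟩

/-- The optimum defining `ciopt` is attained. -/
theorem Instance.exists_ciopt (κ : Cart) {c : ℕ} (hc : 1 ≤ c) : ∃ P : Plan I.n,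
    P.Feasible c I.items ∅ ∧ I.ciopt κ c = finishTime κ w I.arrival 0 w.depot P.actions ∧
    ∀ Q : Plan I.n, Q.Feasible c I.items ∅ →
      I.ciopt κ c ≤ finishTime κ w I.arrival 0 w.depot Q.actions := by
  obtain ⟨P, h1, h2⟩ := Set.exists_min_image _
    (fun P : Plan I.n => finishTime κ w I.arrival 0 w.depot P.actions)
    (finite_feasible c I.items ∅) (feasible_exists hc I.items ∅ (by simp))
  have : I.ciopt κ c = finishTime κ w I.arrival 0 w.depot P.actions := by
    refine IsLeast.csInf_eq ⟨⟨P, h1, rfl⟩, ?_⟩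
    rintro _ ⟨Q, hQ, rfl⟩
    exact h2 Q hQ
  exact ⟨P, h1, this, fun Q hQ => this ▸ h2 Q hQ⟩

/-- What is needed of the rest of a batch sequence for the cart not to overflow. -/
def Fits {n : ℕ} (c : ℕ) : Finset (Fin n) → List (Action n) → Prop
  | C, [] => C.card ≤ c
  | C, Action.pick x :: l => C.card ≤ c ∧ Fits c (insert x.1 C) l
  | C, Action.close :: l => C.card ≤ c ∧ Fits c ∅ l

theorem Fits.card {n c : ℕ} {C : Finset (Fin n)} {l : List (Action n)} (h : Fits c C l) :
    C.card ≤ c := by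
  rcases l with _ | ⟨_ | _, l⟩
  · exact h
  · exact h.1
  · exact h.1

theorem fits_batch {n c : ℕ} (B : List (Item n)) (l : List (Action n)) (hl : Fits c ∅ l) :
    ∀ C : Finset (Fin n), (C ∪ ordersOf B).card ≤ c →
      Fits c C (B.map Action.pick ++ [Action.close] ++ l) := by
  induction B with
  | nil => intro C hC; exact ⟨by simpa [ordersOf] using hC, hl⟩
  | cons x B ih =>
    intro C hC
    refine ⟨(Finset.card_le_card Finset.subset_union_left).trans hC, ih _ ?_⟩
    convert hC using 2
    ext i; simp [ordersOf]

theorem fits_plan {n c : ℕ} {S : Finset (Item n)} {C : Finset (Fin n)} (hC : C.card ≤ c)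
    {P : Plan n} (hP : P.Feasible c S C) : Fits c C P.actions := by
  have key : ∀ Q : Plan n, (∀ B ∈ Q, (ordersOf B).card ≤ c) → Fits c ∅ Q.actions := by
    intro Q hQ
    induction Q with
    | nil => simp [Plan.actions, Fits]
    | cons B Q ih =>
      rw [Plan.actions, List.flatMap_cons]
      refine fits_batch B _ (ih fun B hB => hQ B (List.mem_cons_of_mem _ hB)) ∅ ?_
      simpa using hQ B List.mem_cons_self
  cases P with
  | nil => simpa [Plan.actions, Fits] using hC
  | cons B Q =>
    rw [Plan.actions, List.flatMap_cons]
    refine fits_batch B _ (key Q fun B' hB' => ?_) C ?_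
    · exact hP.batch_card _ (by
        simp only [Plan.batches, List.mem_cons, List.mem_map]
        exact Or.inr ⟨B', hB', rfl⟩)
    · exact hP.batch_card _ (by simp [Plan.batches])

theorem mem_floor_of_mem_arrived {t : ℝ} {x : Item I.n} (hx : x ∈ I.arrived t) :
    x.2 ∈ w.floor := by
  simp only [Instance.arrived, Finset.mem_biUnion, Finset.mem_image] at hx
  obtain ⟨j, -, p, hp, rfl⟩ := hx
  obtain ⟨i, hi⟩ := Set.mem_iUnion.1 (I.order_subset j hp).1
  exact mem_floor (k := .inl i) hi

theorem Instance.exists_exec (κ : Cart) {c : ℕ} (l : List (Action I.n))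
    (hl : ∀ x, Action.pick x ∈ l → x.2 ∈ w.floor) : ∀ (s : I.State) (τ : ℝ), 0 ≤ τ →
    s.pos ∈ w.floor → Fits c s.cart l →
    ∃ s', I.Exec κ s l τ s' ∧ s'.pos ∈ w.floor ∧ s'.cart.card ≤ c := by
  induction l with
  | nil => intro s τ _ h hf; exact ⟨s, .idle s τ, h, hf.card⟩
  | cons x l ih =>
    intro s τ h0 hs hf
    have ht : target κ w s.pos x ∈ w.floor := by
      rcases x with x | _
      · exact hl x List.mem_cons_self
      · cases κ
        · exact w.depot_mem
        · exact hs
    rcases lt_or_ge τ (w.dist s.pos (target κ w s.pos x)) with h | h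
    · obtain ⟨y, hy, h1, h2⟩ := exists_between hs ht h0 h.le
      exact ⟨_, .underway s x l τ y h hy h1 h2, hy, hf.card⟩
    · obtain ⟨s', h1, h2, h3⟩ := ih (fun x hx => hl x (List.mem_cons_of_mem _ hx))
        (I.perform κ s x) _ (sub_nonneg.2 h) (by cases x <;> exact ht)
        (by cases x <;> exact hf.2)
      exact ⟨s', .step s x l τ s' h h1, h2, h3⟩

/-- Reoptimization can always be carried out. -/
theorem exists_isReopt (κ : Cart) (w : Warehouse) {c : ℕ} (hc : 1 ≤ c) :
    ∃ R, IsReopt κ w c R := by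
  have key : ∀ (I : Instance w) (l : List ℝ), l.SortedLE → ∀ s : I.State, s.pos ∈ w.floor →
      s.cart.card ≤ c → ∃ v, I.ReoptFrom κ c l s v := by
    intro I l
    induction l with
    | nil => intro _ s _ _; exact ⟨0, rfl⟩
    | cons t ts ih =>
      intro hl s h1 h2
      obtain ⟨P, hP⟩ := I.exists_optimal κ hc t s h2
      cases ts with
      | nil => exact ⟨_, P, hP, rfl⟩
      | cons t' ts =>
        have hl' := List.pairwise_cons.1 hl.pairwise
        obtain ⟨s', h3, h4, h5⟩ := I.exists_exec κ P.actions (c := c) (by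
            intro x hx
            refine mem_floor_of_mem_arrived I (t := t) (x := x) ?_
            have : x ∈ P.flatten := by
              simp only [Plan.actions, List.mem_flatMap, List.mem_append, List.mem_map,
                List.mem_singleton, reduceCtorEq, or_false, Action.pick.injEq,
                exists_eq_right] at hx
              exact List.mem_flatten.2 hx
            rw [← List.mem_toFinset, hP.1.toFinset_eq, Finset.mem_sdiff] at this
            exact this.1) s (t' - t) (sub_nonneg.2 (hl'.1 t' List.mem_cons_self)) h1
          (fits_plan h2 hP.1)
        obtain ⟨v, hv⟩ := ih hl'.2.sortedLE s' h4 h5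
        exact ⟨v, P, hP, s', h3, hv⟩
  choose R hR using fun I : Instance w => key I I.arrivalTimes
    (Finset.pairwise_sort _ _).sortedLE I.init w.depot_mem (by simp [Instance.init])
  exact ⟨R, hR⟩

end OrderPicking

end

noncomputable section

namespace OrderPicking
open Layout

/-! ### The metric of the warehouse -/

namespace Layout
variable {w : Layout}

/-! Reoptimization can be made to oscillate for arbitrarily long without picking anything. Fix two
points `u`, `v` at distance D > 0. With a pushcart, `u` is the depot and every order is one item at
`v`; with a robot, every order has one item at `u` and one at `v`, and `v` is closer to the depot. A
batch of such orders takes time λ = 2D or λ = D respectively, however many orders it holds. Write c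
= d + 1, so that d ≥ 1.

At time 0 come d orders. Every optimal plan picks their items at `v` and then heads for `u`, with
one bin still free. At distance σ = δ + ε from `v` the picker learns of a single new order. Going
back for it takes σ + D until `u` is reached; going on takes D - σ and later a further batch λ. As σ
< λ/2, she turns back. At distance ε from `v` she learns of d more orders. The d + 1 new orders now
need a batch of their own whether or not one of them uses the free bin, so the way back to `v` is
wasted and she turns to `u`. After a time δ she is again at distance σ from `v`, the next single
order arrives, and so on. With δ + 2ε = λ/2 both preferences are strict, so tie-breaking between
plans is irrelevant; tie-breaking between paths is irrelevant because only the distances to `u` and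
`v` matter.

After K rounds, which last about 2Kδ = K(λ - 4ε), there are still K full batches to do, so the
completion time is about 2Kλ - 4Kε or more. With complete information, each group of d + 1 orders is
served in one batch as the groups come in, one per 2δ ≤ λ, and everything is done by Kλ plus a
constant. Small ε and large K give the ratio 2.

The two turns are `Plan.Optimal.heads_right` and `Plan.Optimal.heads_left`. Both compare the plan of
`exists_plan` with the lower bound `Plan.Feasible.first_move`. `Plan.Optimal.start` treats the
beginning, `waves_reoptFrom` iterates the turns, `waves_ciopt_le` bounds the optimum and
`two_le_asympRatio` combines the bounds. -/

theorem Walk.manhattan_le {p q : Point} {ℓ : ℝ} (h : w.Walk p q ℓ) :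
    |p.1 - q.1| + |p.2 - q.2| ≤ ℓ := by
  induction h with
  | nil => simp
  | @cons p q r ℓ k hp hq h ih =>
    have h1 := abs_sub_le p.1 q.1 r.1
    have h2 := abs_sub_le p.2 q.2 r.2
    linarith

theorem manhattan_le_dist {p q : Point} (hp : p ∈ w.floor) (hq : q ∈ w.floor) :
    |p.1 - q.1| + |p.2 - q.2| ≤ w.dist p q :=
  le_csInf (exists_walk hp hq) fun _ h => Walk.manhattan_le h

theorem floor_of_pickingLocations {p : Point} (hp : p ∈ w.pickingLocations) : p ∈ w.floor := by
  obtain ⟨i, hi⟩ := Set.mem_iUnion.1 hp.1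
  exact mem_floor (k := .inl i) hi

/-- A point of the floor whose height is not that of a cross-aisle is a picking location. -/
theorem mem_pickingLocations {p : Point} (hp : p ∈ w.floor)
    (h : ∀ j : ℕ, p.2 ≠ (j : ℝ) * (w.W / ((w.b : ℝ) - 1))) : p ∈ w.pickingLocations := by
  obtain ⟨k, hk⟩ := Set.mem_iUnion.1 hp
  refine ⟨?_, fun h' => ?_⟩
  · rcases k with i | j
    · exact Set.mem_iUnion.2 ⟨i, hk⟩
    · exact absurd hk.1 (h j)
  · obtain ⟨j, hj⟩ := Set.mem_iUnion.1 h'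
    exact h j hj.1

/-- There is a point of the floor at positive distance from `o` all whose neighbours are picking
locations. -/
theorem exists_location {o : Point} (ho : o ∈ w.floor) : ∃ u ∈ w.floor, 0 < w.dist o u ∧
    ∃ e > 0, ∀ z ∈ w.floor, w.dist u z ≤ e → z ∈ w.pickingLocations := by
  have hb : (1 : ℝ) ≤ (w.b : ℝ) - 1 := by
    have : (2 : ℝ) ≤ w.b := by exact_mod_cast w.two_le_b
    linarith
  set g := w.W / ((w.b : ℝ) - 1) with hg
  have hg0 : 0 < g := div_pos w.W_pos (by linarith)
  have hgW : g ≤ w.W := div_le_self w.W_pos.le hb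
  -- The cross-aisles lie at multiples of g. A point at height θg is at least g/3 away from all of
  -- them, so points within g/4 of it avoid them.
  have key : ∀ θ : ℝ, 1 / 3 ≤ θ → θ ≤ 2 / 3 → ((0 : ℝ), θ * g) ∈ w.floor ∧
      ∀ z ∈ w.floor, w.dist (0, θ * g) z ≤ g / 4 → z ∈ w.pickingLocations := by
    intro θ h1 h2
    have hu : ((0 : ℝ), θ * g) ∈ w.floor := by
      refine mem_floor (k := .inl ⟨0, w.one_le_a⟩) ⟨by simp, ?_, ?_⟩
      · simp only; positivity
      · simp only; nlinarith
    refine ⟨hu, fun z hz hd => mem_pickingLocations hz fun j hj => ?_⟩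
    have h3 := manhattan_le_dist hu hz
    have h4 : |θ * g - z.2| ≤ g / 4 := by
      have := abs_nonneg ((0 : ℝ) - z.1)
      simp only at h3
      linarith
    rw [hj, ← hg, abs_le] at h4
    rcases Nat.eq_zero_or_pos j with rfl | hj1
    · simp only [CharP.cast_eq_zero, zero_mul, sub_zero] at h4
      nlinarith
    · have : (1 : ℝ) ≤ j := by exact_mod_cast hj1
      nlinarith
  -- One of the two heights differs from that of `o`; this suffices for a positive distance even if
  -- there is only one aisle.
  obtain ⟨θ, h1, h2, h3⟩ : ∃ θ : ℝ, 1 / 3 ≤ θ ∧ θ ≤ 2 / 3 ∧ o.2 ≠ θ * g := by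
    by_cases h : o.2 = 1 / 3 * g
    · exact ⟨2 / 3, by norm_num, le_rfl, by rw [h]; intro h'; nlinarith⟩
    · exact ⟨1 / 3, le_rfl, by norm_num, h⟩
  obtain ⟨hu, hz⟩ := key θ h1 h2
  refine ⟨_, hu, ?_, g / 4, by positivity, hz⟩
  have h4 := manhattan_le_dist ho hu
  have h5 : 0 < |o.2 - θ * g| := abs_pos.2 (sub_ne_zero.2 h3)
  have := abs_nonneg (o.1 - 0)
  simp only at h4
  linarith

/-- There are two different picking locations, one of them closer to `o`. -/
theorem exists_closer {o : Point} (ho : o ∈ w.floor) : ∃ u ∈ w.pickingLocations,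
    ∃ v ∈ w.pickingLocations, 0 < w.dist u v ∧ w.dist o v < w.dist o u := by
  obtain ⟨u, hu, hd, e, he, h⟩ := exists_location ho
  have hm : 0 < min e (w.dist o u) := lt_min he hd
  -- `v` lies on a shortest path from `u` to `o`, so close to `u` that it is still a picking
  -- location.
  obtain ⟨v, hv, h1, h2⟩ := exists_between hu ho hm.le
    (by rw [dist_comm u o]; exact min_le_right _ _)
  refine ⟨u, h u hu (by rw [dist_self hu]; exact he.le), v, h v hv (h1 ▸ min_le_left _ _),
    h1 ▸ hm, ?_⟩
  rw [dist_comm o v, h2, dist_comm u o]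
  linarith

end Layout

/-! ### Completion times -/

section FinishTime
variable {n : ℕ} {κ : Cart} {w : Warehouse} {r : Fin n → ℝ}

/-- The place where a sequence of actions ends. -/
def endPoint (κ : Cart) (w : Warehouse) : Point → List (Action n) → Point :=
  List.foldl (target κ w)

/-- All items of a sequence of actions are on the floor. -/
def OnFloor (w : Warehouse) (l : List (Action n)) : Prop :=
  ∀ x : Item n, Action.pick x ∈ l → x.2 ∈ w.floor

theorem OnFloor.tail {x : Action n} {l : List (Action n)} (h : OnFloor w (x :: l)) : OnFloor w l :=
  fun y hy => h y (List.mem_cons_of_mem _ hy)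

theorem OnFloor.target_mem {x : Action n} {l : List (Action n)} (h : OnFloor w (x :: l)) {p : Point}
    (hp : p ∈ w.floor) : target κ w p x ∈ w.floor := by
  rcases x with x | _
  · exact h x List.mem_cons_self
  · cases κ
    · exact w.depot_mem
    · exact hp

theorem OnFloor.left {l l' : List (Action n)} (h : OnFloor w (l ++ l')) : OnFloor w l :=
  fun y hy => h y (List.mem_append_left _ hy)

theorem OnFloor.right {l l' : List (Action n)} (h : OnFloor w (l ++ l')) : OnFloor w l' :=
  fun y hy => h y (List.mem_append_right _ hy)

theorem endPoint_mem {l : List (Action n)} (hl : OnFloor w l) {p : Point} (hp : p ∈ w.floor) :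
    endPoint κ w p l ∈ w.floor := by
  induction l generalizing p with
  | nil => exact hp
  | cons x l ih => exact ih hl.tail (hl.target_mem hp)

theorem finishTime_append (l l' : List (Action n)) (t : ℝ) (p : Point) :
    finishTime κ w r t p (l ++ l') =
      finishTime κ w r (finishTime κ w r t p l) (endPoint κ w p l) l' := by
  induction l generalizing t p with
  | nil => rfl
  | cons x l ih => exact ih _ _

theorem finishTime_mono (l : List (Action n)) {t t' : ℝ} (h : t ≤ t') (p : Point) :
    finishTime κ w r t p l ≤ finishTime κ w r t' p l := by
  induction l generalizing t t' p with
  | nil => exact h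
  | cons x l ih =>
    refine ih (max_le_max (by linarith) ?_) _
    cases x
    · exact le_rfl
    · exact h

theorem endPoint_dist_le_finishTime {l : List (Action n)} (hl : OnFloor w l) (t : ℝ) {p : Point}
    (hp : p ∈ w.floor) : t + w.dist p (endPoint κ w p l) ≤ finishTime κ w r t p l := by
  induction l generalizing t p with
  | nil => simp [endPoint, finishTime, dist_self hp]
  | cons x l ih =>
    have hx := hl.target_mem (κ := κ) hp
    have h1 := ih hl.tail (max (t + w.dist p (target κ w p x)) (release r t x)) hx
    have h2 := le_max_left (t + w.dist p (target κ w p x)) (release r t x)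
    have h3 := dist_triangle hp hx (endPoint_mem (κ := κ) hl.tail hx)
    exact le_trans (by change _ + w.dist p (endPoint κ w (target κ w p x) l) ≤ _; linarith) h1

theorem le_finishTime {l : List (Action n)} (t : ℝ) (p : Point) :
    t ≤ finishTime κ w r t p l := by
  induction l generalizing t p with
  | nil => exact le_rfl
  | cons x l ih =>
    have h1 := dist_nonneg (w := w.toLayout) p (target κ w p x)
    exact (le_max_of_le_left (by linarith)).trans (ih _ _)

/-- Only the triangle inequality is needed, since release times can only delay the picker. -/
theorem detour_le_finishTime {l : List (Action n)} (hl : OnFloor w l) (t : ℝ) {p : Point}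
    (hp : p ∈ w.floor) {x : Item n} (hx : Action.pick x ∈ l) :
    t + w.dist p x.2 + w.dist x.2 (endPoint κ w p l) ≤ finishTime κ w r t p l := by
  induction l generalizing t p with
  | nil => simp at hx
  | cons y l ih =>
    have hy := hl.target_mem (κ := κ) hp
    have h2 := le_max_left (t + w.dist p (target κ w p y)) (release r t y)
    have hxf := hl x hx
    rcases List.mem_cons.1 hx with rfl | hx
    · have := endPoint_dist_le_finishTime (κ := κ) (r := r) hl.tail
        (max (t + w.dist p x.2) (release r t (Action.pick x))) hxf
      exact le_trans (by simp [endPoint, target]) this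
    · have h1 := ih hl.tail (max (t + w.dist p (target κ w p y)) (release r t y)) hy hx
      have h3 := dist_triangle hp hy hxf
      exact le_trans (by
        change _ + w.dist x.2 (endPoint κ w (target κ w p y) l) ≤ _; linarith) h1

/-- It does not matter which of the two items is picked first: the detours via `x` and via `y`
together form a closed tour through both places, of length at least twice their distance. -/
theorem dist_le_finishTime {l : List (Action n)} (hl : OnFloor w l) (t : ℝ) {p : Point}
    (hp : p ∈ w.floor) {x y : Item n} (hx : Action.pick x ∈ l) (hy : Action.pick y ∈ l) :
    t + w.dist x.2 y.2 ≤ finishTime κ w r t p l := by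
  have h1 := detour_le_finishTime (κ := κ) (r := r) hl t hp hx
  have h2 := detour_le_finishTime (κ := κ) (r := r) hl t hp hy
  have he := endPoint_mem (κ := κ) hl hp
  have h3 := dist_triangle (hl x hx) he (hl y hy)
  have h4 := dist_triangle (hl x hx) hp (hl y hy)
  rw [Layout.dist_comm x.2 p] at h4
  rw [Layout.dist_comm (endPoint κ w p l)] at h3
  linarith

theorem finishTime_stay (B : List (Item n)) (l : List (Action n)) {t : ℝ} {p : Point}
    (hp : p ∈ w.floor) (hB : ∀ x ∈ B, x.2 = p ∧ r x.1 ≤ t) :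
    finishTime κ w r t p (B.map Action.pick ++ l) = finishTime κ w r t p l := by
  induction B with
  | nil => rfl
  | cons x B ih =>
    obtain ⟨h1, h2⟩ := hB x List.mem_cons_self
    rw [← ih fun y hy => hB y (List.mem_cons_of_mem _ hy)]
    simp [finishTime, target, release, h1, h2, dist_self hp]

theorem finishTime_visit {B : List (Item n)} (hne : B ≠ []) (l : List (Action n)) {t : ℝ}
    {p q : Point} (hq : q ∈ w.floor) (hB : ∀ x ∈ B, x.2 = q ∧ r x.1 ≤ t) :
    finishTime κ w r t p (B.map Action.pick ++ l) = finishTime κ w r (t + w.dist p q) q l := by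
  cases B with
  | nil => exact absurd rfl hne
  | cons x B =>
    have h0 := dist_nonneg (w := w.toLayout) p q
    obtain ⟨h1, h2⟩ := hB x List.mem_cons_self
    have := finishTime_stay (κ := κ) (t := t + w.dist p q) B l hq fun y hy =>
      ⟨(hB y (List.mem_cons_of_mem _ hy)).1, by
        have := (hB y (List.mem_cons_of_mem _ hy)).2; linarith⟩
    rw [← this]
    have h3 : r x.1 ≤ t + w.dist p q := by linarith
    simp [finishTime, target, release, h1, h3]

end FinishTime

/-! ### Shuttling between two points -/

/-- The locations of the items of an order which makes the picker shuttle between `u` and `v`. -/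
def stops (κ : Cart) (u v : Point) : Finset Point :=
  match κ with
  | Cart.pushcart => {v}
  | Cart.robot => {u, v}

/-- The time needed for a batch, if the distance between `u` and `v` is `D`. -/
def batchTime (κ : Cart) (D : ℝ) : ℝ :=
  match κ with
  | Cart.pushcart => 2 * D
  | Cart.robot => D

/-- The picker shuttles between `u` and `v`, where `u` is the depot in case of a pushcart, and `v`
is closer to the depot in case of a robot. -/
structure IsShuttle (κ : Cart) (w : Warehouse) (u v : Point) : Prop where
  left_mem : u ∈ w.floor
  right_mem : v ∈ w.floor
  dist_pos : 0 < w.dist u v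
  eq_depot : κ = Cart.pushcart → u = w.depot
  closer : κ = Cart.robot → w.dist w.depot v < w.dist w.depot u

theorem right_mem_stops {κ : Cart} {u v : Point} : v ∈ stops κ u v := by
  cases κ <;> simp [stops]

theorem mem_stops {κ : Cart} {u v x : Point} :
    x ∈ stops κ u v ↔ x = v ∨ (κ = Cart.robot ∧ x = u) := by
  cases κ <;> simp [stops, or_comm]

theorem IsShuttle.ne {κ : Cart} {w : Warehouse} {u v : Point} (h : IsShuttle κ w u v) : u ≠ v := by
  rintro rfl
  have := h.dist_pos
  rw [dist_self h.left_mem] at this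
  exact this.false

/-! ### Construction of shuttling plans: feasibility and completion times -/

section Plans
variable {n : ℕ} {κ : Cart} {w : Warehouse} {r : Fin n → ℝ} {u v : Point}

theorem mem_ordersOf {B : List (Item n)} {j : Fin n} : j ∈ ordersOf B ↔ ∃ x, (j, x) ∈ B := by
  simp [ordersOf]

theorem Plan.actions_cons (B : List (Item n)) (P : Plan n) :
    Plan.actions (B :: P) = B.map Action.pick ++ Action.close :: Plan.actions P := by
  simp [Plan.actions]

theorem pick_mem_actions {P : Plan n} {x : Item n} : Action.pick x ∈ P.actions ↔ x ∈ P.flatten := by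
  simp [Plan.actions, List.mem_flatten]

/-- The items of the commenced orders `X` at `u`. -/
def remainder (κ : Cart) (u : Point) (X : Finset (Fin n)) : List (Item n) :=
  match κ with
  | Cart.pushcart => []
  | Cart.robot => X.toList.map fun j => (j, u)

/-- A batch that visits first `v`, then `u`. -/
def firstBatch (κ : Cart) (u v : Point) (Y X : Finset (Fin n)) : List (Item n) :=
  Y.toList.map (fun j => (j, v)) ++ remainder κ u X

/-- Batches for groups of orders, starting at `u`. -/
def sweeps (κ : Cart) : Point → Point → List (Finset (Fin n)) → Plan n
  | _, _, [] => []
  | u, v, G :: Gs =>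
    match κ with
    | Cart.pushcart => (G.toList.map fun j => (j, v)) :: sweeps κ u v Gs
    -- A robot begins the next batch where it ended the last one, so the two end points change
    -- roles.
    | Cart.robot => (G.toList.map (fun j => (j, u)) ++ G.toList.map fun j => (j, v)) ::
        sweeps κ v u Gs

theorem nodup_map_mk (G : Finset (Fin n)) (p : Point) :
    (G.toList.map fun j => ((j, p) : Item n)).Nodup :=
  (Finset.nodup_toList G).map fun _ _ h => (Prod.ext_iff.1 h).1

theorem nodup_map_append (G H : Finset (Fin n)) {p q : Point} (h : p ≠ q) :
    (G.toList.map (fun j => ((j, p) : Item n)) ++ H.toList.map fun j => (j, q)).Nodup := by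
  rw [List.nodup_append']
  refine ⟨nodup_map_mk G p, nodup_map_mk H q, fun x hx hx' => h ?_⟩
  obtain ⟨i, -, rfl⟩ := List.mem_map.1 hx
  obtain ⟨j, -, hj⟩ := List.mem_map.1 hx'
  exact (Prod.ext_iff.1 hj).2.symm

theorem stops_comm : stops Cart.robot u v = stops Cart.robot v u := by
  simp [stops, Finset.pair_comm]

theorem sweeps_spec (huv : u ≠ v) (Gs : List (Finset (Fin n))) :
    List.Forall₂ (fun B G => B.Nodup ∧ ∀ x : Item n, x ∈ B ↔ x.1 ∈ G ∧ x.2 ∈ stops κ u v)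
      (sweeps κ u v Gs) Gs := by
  induction Gs generalizing u v with
  | nil => simp [sweeps]
  | cons G Gs ih =>
    cases κ
    · refine List.Forall₂.cons ⟨nodup_map_mk G v, ?_⟩ (ih huv)
      rintro ⟨j, x⟩
      simp [stops, eq_comm]
    · refine List.Forall₂.cons ⟨nodup_map_append G G huv, ?_⟩ ?_
      · rintro ⟨j, x⟩
        simp only [List.mem_append, List.mem_map, Finset.mem_toList, Prod.mk.injEq, stops,
          Finset.mem_insert, Finset.mem_singleton]
        constructor
        · rintro (⟨_, h, rfl, rfl⟩ | ⟨_, h, rfl, rfl⟩) <;> simp [h]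
        · rintro ⟨h, rfl | rfl⟩ <;> simp [h]
      · rw [stops_comm]
        exact ih huv.symm

/-- Since the batches have disjoint sets of orders, no item can occur in two of them; repetitions
have to be excluded only within a batch. -/
theorem feasible_cons {c : ℕ} {S : Finset (Item n)} {C : Finset (Fin n)} {B : List (Item n)}
    {P : Plan n} (hB : B.Nodup) (hP : ∀ B' ∈ P, B'.Nodup)
    (hS : ∀ x, x ∈ S ↔ x ∈ B ∨ ∃ B' ∈ P, x ∈ B')
    (hne : ∀ G ∈ (C ∪ ordersOf B) :: P.map ordersOf, G.Nonempty)
    (hc : ∀ G ∈ (C ∪ ordersOf B) :: P.map ordersOf, G.card ≤ c)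
    (hd : ((C ∪ ordersOf B) :: P.map ordersOf).Pairwise Disjoint) :
    Plan.Feasible c S C (B :: P) := by
  refine ⟨?_, ?_, fun _ => List.cons_ne_nil _ _, hne, hc, hd⟩
  · rw [List.nodup_flatten]
    refine ⟨fun B' h => ?_, ?_⟩
    · rcases List.mem_cons.1 h with rfl | h
      · exact hB
      · exact hP _ h
    · have key : ∀ B B' : List (Item n), Disjoint (ordersOf B) (ordersOf B') →
          List.Disjoint B B' := fun B B' h x hx hx' =>
        Finset.disjoint_left.1 h (mem_ordersOf.2 ⟨x.2, hx⟩) (mem_ordersOf.2 ⟨x.2, hx'⟩)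
      rw [List.pairwise_cons, List.pairwise_map] at hd
      refine List.pairwise_cons.2 ⟨fun B' h => key _ _ ?_, hd.2.imp (key _ _)⟩
      exact (hd.1 _ (List.mem_map_of_mem h)).mono_left Finset.subset_union_right
  · ext x
    rw [hS]
    simp

theorem mem_remainder {X : Finset (Fin n)} {x : Item n} :
    x ∈ remainder κ u X ↔ κ = Cart.robot ∧ x.1 ∈ X ∧ x.2 = u := by
  obtain ⟨j, y⟩ := x
  cases κ <;> simp [remainder, eq_comm]

theorem mem_firstBatch {X Y : Finset (Fin n)} {x : Item n} : x ∈ firstBatch κ u v Y X ↔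
    (x.1 ∈ Y ∧ x.2 = v) ∨ κ = Cart.robot ∧ x.1 ∈ X ∧ x.2 = u := by
  obtain ⟨j, y⟩ := x
  simp [firstBatch, mem_remainder, eq_comm]

/-- In the intended use, the items at `v` of the commenced orders `C` are already in the cart and
the orders in `Y` join them in the free bins. The first batch then lacks `Y` at `v` and, for a
robot, all of `X` at `u`. -/
theorem feasible_firstBatch {c : ℕ} {S : Finset (Item n)} {C X Y : Finset (Fin n)}
    {Gs : List (Finset (Fin n))} (huv : u ≠ v) (hX : C ∪ Y = X)
    (hS : ∀ x, x ∈ S ↔ ((x.1 ∈ Y ∧ x.2 = v) ∨ κ = Cart.robot ∧ x.1 ∈ X ∧ x.2 = u) ∨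
      ∃ G ∈ Gs, x.1 ∈ G ∧ x.2 ∈ stops κ u v)
    (hne : ∀ G ∈ X :: Gs, G.Nonempty) (hc : ∀ G ∈ X :: Gs, G.card ≤ c)
    (hd : (X :: Gs).Pairwise Disjoint) :
    Plan.Feasible c S C (firstBatch κ u v Y X :: sweeps κ u v Gs) := by
  have hsp := sweeps_spec (κ := κ) huv Gs
  have h1 : C ∪ ordersOf (firstBatch κ u v Y X) = X := by
    ext j
    rw [Finset.mem_union, mem_ordersOf]
    constructor
    · rintro (h | ⟨x, h⟩)
      · exact hX ▸ Finset.mem_union_left _ h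
      · rcases mem_firstBatch.1 h with h | h
        · exact hX ▸ Finset.mem_union_right _ h.1
        · exact h.2.1
    · intro h
      rw [← hX, Finset.mem_union] at h
      exact h.imp_right fun h => ⟨v, mem_firstBatch.2 (Or.inl ⟨h, rfl⟩)⟩
  have h2 : (sweeps κ u v Gs).map ordersOf = Gs := by
    have := hsp.imp (S := fun B G => ordersOf B = G) fun B G h => by
      ext j
      rw [mem_ordersOf]
      simp only [h.2]
      exact ⟨fun ⟨x, hx⟩ => hx.1, fun hj => ⟨v, hj, right_mem_stops⟩⟩
    rw [← List.forall₂_map_left_iff (f := ordersOf) (R := Eq)] at this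
    exact List.forall₂_eq_eq_eq ▸ this
  have h3 : ∀ x : Item n, (∃ B ∈ sweeps κ u v Gs, x ∈ B) ↔
      ∃ G ∈ Gs, x.1 ∈ G ∧ x.2 ∈ stops κ u v := by
    intro x
    revert hsp
    generalize sweeps κ u v Gs = P
    intro h
    clear hS hne hc hd h2
    induction h with
    | nil => simp
    | cons hBG _ ih => simp [ih, hBG.2]
  refine feasible_cons ?_ ?_ ?_ (by rwa [h1, h2]) (by rwa [h1, h2]) (by rwa [h1, h2])
  · cases κ
    · simpa [firstBatch, remainder] using nodup_map_mk Y v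
    · exact nodup_map_append Y X huv.symm
  · intro B hB
    obtain ⟨i, hi, rfl⟩ := List.mem_iff_getElem.1 hB
    exact ((List.forall₂_iff_get.1 hsp).2 i hi (hsp.length_eq ▸ hi)).1
  · intro x
    rw [hS, h3, mem_firstBatch]

/-- By `hr`, each group has arrived when its batch begins, so the picker never waits. -/
theorem finishTime_sweeps (hu : u ∈ w.floor) (hv : v ∈ w.floor)
    (hdep : κ = Cart.pushcart → u = w.depot) (Gs : List (Finset (Fin n)))
    (hne : ∀ G ∈ Gs, G.Nonempty) (t : ℝ)
    (hr : ∀ i, ∀ hi : i < Gs.length, ∀ j ∈ Gs[i], r j ≤ t + batchTime κ (w.dist u v) * i) :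
    finishTime κ w r t u (sweeps κ u v Gs).actions ≤
      t + batchTime κ (w.dist u v) * Gs.length := by
  induction Gs generalizing u v t with
  | nil => simp [sweeps, Plan.actions, finishTime]
  | cons G Gs ih =>
    have hD := dist_nonneg (w := w.toLayout) u v
    have hG : ∀ p : Point, (G.toList.map fun j => ((j, p) : Item n)) ≠ [] := by
      intro p h
      have := hne G List.mem_cons_self
      simp only [List.map_eq_nil_iff, Finset.toList_eq_nil] at h
      exact this.ne_empty h
    have hG' : ∀ p : Point, ∀ x ∈ (G.toList.map fun j => ((j, p) : Item n)),
        x.2 = p ∧ r x.1 ≤ t := by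
      intro p x hx
      obtain ⟨j, hj, rfl⟩ := List.mem_map.1 hx
      exact ⟨rfl, by simpa using hr 0 (by simp) j (by simpa using hj)⟩
    have hne' := fun G h => hne G (List.mem_cons_of_mem _ h)
    have hr' : ∀ i, ∀ hi : i < Gs.length, ∀ j ∈ Gs[i],
        r j ≤ t + batchTime κ (w.dist u v) + batchTime κ (w.dist u v) * i := by
      intro i hi j hj
      have := hr (i + 1) (by simpa using hi) j (by simpa using hj)
      push_cast at this
      linarith
    cases κ
    · have hsw : sweeps Cart.pushcart u v (G :: Gs) =
          (G.toList.map fun j => (j, v)) :: sweeps Cart.pushcart u v Gs := rfl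
      rw [hsw, Plan.actions_cons, finishTime_visit (hG v) _ hv (hG' v)]
      have := ih hu hv hdep hne' _ hr'
      have e : max (t + w.dist u v + w.dist v w.depot) (t + w.dist u v) =
          t + batchTime Cart.pushcart (w.dist u v) := by
        rw [← hdep rfl, Layout.dist_comm v u, max_eq_left (by linarith)]
        simp only [batchTime]; ring
      rw [finishTime]
      simp only [target, release]
      rw [e, ← hdep rfl]
      refine this.trans (le_of_eq ?_)
      push_cast [List.length_cons]; ring
    · have hsw : sweeps Cart.robot u v (G :: Gs) =
          (G.toList.map (fun j => (j, u)) ++ G.toList.map fun j => (j, v)) ::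
            sweeps Cart.robot v u Gs := rfl
      rw [hsw, Plan.actions_cons, List.map_append, List.append_assoc,
        finishTime_stay _ _ hu (hG' u), finishTime_visit (hG v) _ hv (hG' v)]
      have := ih hv hu (fun h => by cases h) hne' (t + batchTime Cart.robot (w.dist u v))
        (by rwa [Layout.dist_comm v u])
      rw [finishTime]
      simp only [target, release, dist_self hv, add_zero, max_self]
      refine this.trans (le_of_eq ?_)
      rw [Layout.dist_comm v u]
      push_cast [List.length_cons]; ring

/-- Completing the commenced batch leads to `u` with either cart: the pushcart returns there, and
the robot has items left there because `X` is nonempty. -/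
theorem finishTime_remainder (hu : u ∈ w.floor) (hdep : κ = Cart.pushcart → u = w.depot)
    {X : Finset (Fin n)} (hX : X.Nonempty) {t : ℝ} (hr : ∀ j ∈ X, r j ≤ t) (p : Point)
    (l : List (Action n)) :
    finishTime κ w r t p ((remainder κ u X).map Action.pick ++ Action.close :: l) =
      finishTime κ w r (t + w.dist p u) u l := by
  cases κ
  · have h0 := dist_nonneg (w := w.toLayout) p w.depot
    simp [remainder, finishTime, target, release, hdep rfl, h0]
  · rw [finishTime_visit (q := u)]
    · simp [finishTime, target, release, dist_self hu]
    · simpa [remainder] using hX.ne_empty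
    · exact hu
    · intro x hx
      obtain ⟨-, h1, h2⟩ := mem_remainder.1 hx
      exact ⟨h2, hr _ h1⟩

/-- The way from `p` via `v` (if `Y` is not empty) to `u`. -/
def firstTime (w : Warehouse) (u v p : Point) (Y : Finset (Fin n)) : ℝ :=
  if Y = ∅ then w.dist p u else w.dist p v + w.dist u v

theorem finishTime_firstBatch (hs : IsShuttle κ w u v) {X Y : Finset (Fin n)} (hX : X.Nonempty)
    (hYX : Y ⊆ X) {t : ℝ} (hr : ∀ j ∈ X, r j ≤ t) (p : Point) (Gs : List (Finset (Fin n)))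
    (hne : ∀ G ∈ Gs, G.Nonempty)
    (hGs : ∀ i, ∀ hi : i < Gs.length, ∀ j ∈ Gs[i],
      r j ≤ t + firstTime w u v p Y + batchTime κ (w.dist u v) * i) :
    finishTime κ w r t p (Plan.actions (firstBatch κ u v Y X :: sweeps κ u v Gs)) ≤
      t + firstTime w u v p Y + batchTime κ (w.dist u v) * Gs.length := by
  have key : finishTime κ w r t p (Plan.actions (firstBatch κ u v Y X :: sweeps κ u v Gs)) =
      finishTime κ w r (t + firstTime w u v p Y) u (sweeps κ u v Gs).actions := by
    rw [Plan.actions_cons, firstBatch, List.map_append, List.append_assoc, firstTime]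
    split_ifs with h
    · subst h
      simp [finishTime_remainder hs.left_mem hs.eq_depot hX hr]
    · rw [finishTime_visit (q := v) _ _ hs.right_mem, finishTime_remainder hs.left_mem hs.eq_depot hX,
        Layout.dist_comm v u, add_assoc]
      · intro j hj
        exact (hr j hj).trans (le_add_of_nonneg_right (dist_nonneg _ _))
      · intro x hx
        obtain ⟨j, hj, rfl⟩ := List.mem_map.1 hx
        exact ⟨rfl, hr _ (hYX (by simpa using hj))⟩
      · simpa using h
  rw [key]
  exact finishTime_sweeps hs.left_mem hs.right_mem hs.eq_depot Gs hne _ hGs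

end Plans

/-! ### Lower bounds for feasible plans -/

section LowerBounds
variable {n c : ℕ} {κ : Cart} {w : Warehouse} {r : Fin n → ℝ} {u v : Point}

namespace Plan.Feasible
variable {S : Finset (Item n)} {C : Finset (Fin n)} {B : List (Item n)} {Q : Plan n}

theorem mem_iff {P : Plan n} (h : P.Feasible c S C) {x : Item n} : x ∈ P.flatten ↔ x ∈ S := by
  rw [← h.toFinset_eq, List.mem_toFinset]

theorem pairwise (h : Plan.Feasible c S C (B :: Q)) :
    (∀ B' ∈ Q, Disjoint (C ∪ ordersOf B) (ordersOf B')) ∧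
      Q.Pairwise fun B' B'' => Disjoint (ordersOf B') (ordersOf B'') := by
  have := List.pairwise_cons.1 h.batch_disjoint
  rw [List.pairwise_map] at this
  exact ⟨fun B' hB' => this.1 _ (List.mem_map_of_mem hB'), this.2⟩

theorem mem_head (h : Plan.Feasible c S C (B :: Q)) {x : Item n} (hx : x ∈ S)
    (hj : x.1 ∈ C ∪ ordersOf B) : x ∈ B := by
  rw [← h.mem_iff, List.flatten_cons, List.mem_append, List.mem_flatten] at hx
  rcases hx with hx | ⟨B', hB', hx⟩
  · exact hx
  · exact absurd (mem_ordersOf.2 ⟨x.2, hx⟩) (Finset.disjoint_left.1 (h.pairwise.1 B' hB') hj)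

theorem mem_tail (h : Plan.Feasible c S C (B :: Q)) {B' : List (Item n)} (hB' : B' ∈ Q)
    {x : Item n} (hx : x ∈ S) (hj : x.1 ∈ ordersOf B') : x ∈ B' := by
  rw [← h.mem_iff, List.flatten_cons, List.mem_append, List.mem_flatten] at hx
  rcases hx with hx | ⟨B'', hB'', hx⟩
  · exact absurd hj (Finset.disjoint_left.1 (h.pairwise.1 B' hB')
      (Finset.mem_union_right _ (mem_ordersOf.2 ⟨x.2, hx⟩)))
  · by_contra hne
    have : Disjoint (ordersOf B'') (ordersOf B') := by
      have : Std.Symm fun B' B'' : List (Item n) => Disjoint (ordersOf B') (ordersOf B'') :=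
        ⟨fun _ _ h => h.symm⟩
      exact h.pairwise.2.forall hB'' hB' (by rintro rfl; exact hne hx)
    exact Finset.disjoint_left.1 this (mem_ordersOf.2 ⟨x.2, hx⟩) hj

theorem card_new_le (h : Plan.Feasible c S C (B :: Q)) :
    C.card + (ordersOf B \ C).card ≤ c := by
  have := h.batch_card (C ∪ ordersOf B) (by simp [Plan.batches])
  rwa [← Finset.union_sdiff_self_eq_union, Finset.card_union_of_disjoint
    Finset.disjoint_sdiff] at this

/-- A count of bins: the orders outside `C` go into the first batch or into later ones, which hold
at most `c` each. -/
theorem card_le (h : Plan.Feasible c S C (B :: Q)) {U : Finset (Fin n)}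
    (hU : ∀ j ∈ U \ C, ∃ y, (j, y) ∈ S) :
    (U \ C).card ≤ (ordersOf B \ C).card + c * Q.length := by
  have key : ∀ Q : Plan n, (∀ B' ∈ Q, (ordersOf B').card ≤ c) →
      ∃ V : Finset (Fin n), V.card ≤ c * Q.length ∧ ∀ B' ∈ Q, ordersOf B' ⊆ V := by
    intro Q hQ
    induction Q with
    | nil => exact ⟨∅, by simp, by simp⟩
    | cons B' Q ih =>
      obtain ⟨V, h1, h2⟩ := ih fun B hB => hQ B (List.mem_cons_of_mem _ hB)
      refine ⟨ordersOf B' ∪ V, ?_, ?_⟩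
      · have := hQ B' List.mem_cons_self
        have := Finset.card_union_le (ordersOf B') V
        rw [List.length_cons, mul_add]
        omega
      · intro B'' hB''
        rcases List.mem_cons.1 hB'' with rfl | hB''
        · exact Finset.subset_union_left
        · exact (h2 _ hB'').trans Finset.subset_union_right
  obtain ⟨V, h1, h2⟩ := key Q fun B' hB' => h.batch_card _ (by
    simp only [Plan.batches, List.mem_cons, List.mem_map]
    exact Or.inr ⟨B', hB', rfl⟩)
  have h3 : U \ C ⊆ (ordersOf B \ C) ∪ V := by
    intro j hj
    obtain ⟨y, hy⟩ := hU j hj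
    rw [Finset.mem_sdiff] at hj
    rw [← h.mem_iff, List.flatten_cons, List.mem_append, List.mem_flatten] at hy
    rw [Finset.mem_union]
    rcases hy with hy | ⟨B', hB', hy⟩
    · exact Or.inl (Finset.mem_sdiff.2 ⟨mem_ordersOf.2 ⟨y, hy⟩, hj.2⟩)
    · exact Or.inr (h2 B' hB' (mem_ordersOf.2 ⟨y, hy⟩))
  have := (Finset.card_le_card h3).trans (Finset.card_union_le _ _)
  omega

theorem onFloor {P : Plan n} (h : P.Feasible c S C) (hS : ∀ x ∈ S, x.2 ∈ w.floor) :
    OnFloor w P.actions := fun x hx => hS x (h.mem_iff.1 (pick_mem_actions.1 hx))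

end Plan.Feasible

/-- The items that are still to be collected for the orders in `A`, if those of the orders in `C`
at `v` have been picked. -/
def pendingItems (κ : Cart) (u v : Point) (A C : Finset (Fin n)) : Finset (Item n) :=
  A ×ˢ stops κ u v \ C ×ˢ {v}

theorem mem_pendingItems {A C : Finset (Fin n)} {x : Item n} : x ∈ pendingItems κ u v A C ↔
    (x.1 ∈ A ∧ x.2 ∈ stops κ u v) ∧ ¬ (x.1 ∈ C ∧ x.2 = v) := by
  rw [pendingItems, Finset.mem_sdiff, Finset.mem_product, Finset.mem_product,
    Finset.mem_singleton]

theorem IsShuttle.mem_floor_of_pending (hs : IsShuttle κ w u v) {A C : Finset (Fin n)} {x : Item n}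
    (hx : x ∈ pendingItems κ u v A C) : x.2 ∈ w.floor := by
  rcases mem_stops.1 (mem_pendingItems.1 hx).1.2 with h | ⟨-, h⟩ <;> rw [h]
  · exact hs.right_mem
  · exact hs.left_mem

theorem endPoint_close (p : Point) (l : List (Action n)) (hκ : κ = Cart.pushcart) :
    endPoint κ w p (l ++ [Action.close]) = w.depot := by
  subst hκ
  simp [endPoint, List.foldl_append, target]

/-- The pushcart starts at the depot `u` and must return from `v`; the robot must visit both `u` and
`v`, wherever it starts. -/
theorem batchTime_le_finishTime (hs : IsShuttle κ w u v) {B : List (Item n)} {j : Fin n}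
    (hB : ∀ y ∈ stops κ u v, (j, y) ∈ B)
    (hl : OnFloor w (B.map Action.pick ++ [Action.close] : List (Action n))) (t : ℝ) {p : Point}
    (hp : p ∈ w.floor) (hdep : κ = Cart.pushcart → p = w.depot) :
    t + batchTime κ (w.dist u v) ≤
      finishTime κ w r t p (B.map Action.pick ++ [Action.close]) := by
  have hmem : ∀ y ∈ stops κ u v,
      Action.pick (j, y) ∈ (B.map Action.pick ++ [Action.close] : List (Action n)) := by
    intro y hy
    simpa using hB y hy
  cases κ
  · have := detour_le_finishTime (κ := Cart.pushcart) (r := r) hl t hp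
      (hmem v right_mem_stops)
    rw [endPoint_close _ _ rfl, hdep rfl, ← hs.eq_depot rfl, Layout.dist_comm v u] at this
    simp only [batchTime]
    rw [hdep rfl, ← hs.eq_depot rfl]
    linarith
  · exact dist_le_finishTime hl t hp (hmem u (by simp [stops])) (hmem v right_mem_stops)

theorem batchTime_mul_le_finishTime (hs : IsShuttle κ w u v) (Q : Plan n)
    (hQ : ∀ B ∈ Q, ∃ j, ∀ y ∈ stops κ u v, (j, y) ∈ B) (hl : OnFloor w Q.actions) (t : ℝ) {p : Point}
    (hp : p ∈ w.floor) (hdep : κ = Cart.pushcart → p = w.depot) :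
    t + batchTime κ (w.dist u v) * Q.length ≤ finishTime κ w r t p Q.actions := by
  induction Q generalizing t p with
  | nil => simp [Plan.actions, finishTime]
  | cons B Q ih =>
    have e : Plan.actions (B :: Q) = (B.map Action.pick ++ [Action.close]) ++ Plan.actions Q := by
      simp [Plan.actions]
    rw [e] at hl ⊢
    obtain ⟨j, hj⟩ := hQ B List.mem_cons_self
    have h1 := batchTime_le_finishTime (r := r) hs hj hl.left t hp hdep
    have h2 := ih (fun B hB => hQ B (List.mem_cons_of_mem _ hB)) hl.right
      (finishTime κ w r t p (B.map Action.pick ++ [Action.close]))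
      (endPoint_mem (κ := κ) hl.left hp) (endPoint_close p _)
    rw [finishTime_append]
    push_cast [List.length_cons]
    linarith

variable {A C : Finset (Fin n)} {B : List (Item n)} {Q : Plan n}

/-- Commenced orders belong to the first batch. An order in a later batch therefore has all its
items pending, and they may not be split; hence each later batch costs at least `batchTime`. -/
theorem Plan.Feasible.full_tail (h : Plan.Feasible c (pendingItems κ u v A C) C (B :: Q)) :
    ∀ B' ∈ Q, ∃ j, ∀ y ∈ stops κ u v, (j, y) ∈ B' := by
  intro B' hB'
  obtain ⟨j, hj⟩ := h.batch_nonempty (ordersOf B') (by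
    simp only [Plan.batches, List.mem_cons, List.mem_map]
    exact Or.inr ⟨B', hB', rfl⟩)
  obtain ⟨x, hx⟩ := mem_ordersOf.1 hj
  have hxS : (j, x) ∈ pendingItems κ u v A C := by
    rw [← h.mem_iff, List.flatten_cons, List.mem_append, List.mem_flatten]
    exact Or.inr ⟨B', hB', hx⟩
  have hjC : j ∉ C := fun hC => Finset.disjoint_left.1 (h.pairwise.1 B' hB')
    (Finset.mem_union_left _ hC) hj
  exact ⟨j, fun y hy => h.mem_tail hB' (mem_pendingItems.2
    ⟨⟨(mem_pendingItems.1 hxS).1.1, hy⟩, fun h => hjC h.1⟩) hj⟩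

/-- The first move of a feasible plan goes to `v` or to `u`, with a lower bound for the completion
time in each case. -/
theorem Plan.Feasible.first_move (hs : IsShuttle κ w u v)
    (h : Plan.Feasible c (pendingItems κ u v A C) C (B :: Q)) (hCA : C ⊆ A) (t : ℝ) (p : Point) :
    ∃ x l, Plan.actions (B :: Q) = x :: l ∧
      ((target κ w p x = v ∧ t + (w.dist p v + w.dist u v) + batchTime κ (w.dist u v) * Q.length ≤
          finishTime κ w r t p (Plan.actions (B :: Q))) ∨
        (target κ w p x = u ∧ t + w.dist p u + batchTime κ (w.dist u v) *
          ((Q.length + min (ordersOf B \ C).card 1 : ℕ) : ℝ) ≤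
            finishTime κ w r t p (Plan.actions (B :: Q)))) := by
  have hfl : OnFloor w (Plan.actions (B :: Q)) := h.onFloor fun x hx => hs.mem_floor_of_pending hx
  rw [Plan.actions_cons] at hfl ⊢
  have htail := batchTime_mul_le_finishTime (r := r) hs Q h.full_tail hfl.right.tail
  cases B with
  | nil =>
    obtain ⟨j, hj⟩ := h.batch_nonempty (C ∪ ordersOf []) (by simp [Plan.batches])
    have hj : j ∈ C := by simpa [ordersOf] using hj
    -- With nothing to pick in the current batch, the pushcart returns at once. For the robot this
    -- cannot occur, as a commenced order still has an item at `u`.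
    cases κ
    · refine ⟨_, _, rfl, Or.inr ⟨(hs.eq_depot rfl).symm, ?_⟩⟩
      have h1 := htail (max (t + w.dist p w.depot) t) w.depot_mem fun _ => rfl
      have h2 := le_max_left (t + w.dist p w.depot) t
      have h3 : ordersOf ([] : List (Item n)) = ∅ := rfl
      rw [h3]
      simp only [List.map_nil, List.nil_append, finishTime, target, release, Finset.empty_sdiff,
        Finset.card_empty, zero_le, inf_of_le_left, add_zero]
      rw [hs.eq_depot rfl] at h1 ⊢
      linarith
    · have := h.mem_head (x := (j, u)) (mem_pendingItems.2
        ⟨⟨hCA hj, by simp [stops]⟩, fun h => hs.ne h.2⟩) (Finset.mem_union_left _ hj)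
      simp at this
  | cons z B =>
    obtain ⟨j, y⟩ := z
    have hS : ∀ x ∈ (j, y) :: B, x ∈ pendingItems κ u v A C := by
      intro x hx
      rw [← h.mem_iff, List.flatten_cons]
      exact List.mem_append_left _ hx
    have e : ((j, y) :: B).map Action.pick ++ Action.close :: Q.actions =
        Action.pick (j, y) :: ((B.map Action.pick ++ [Action.close]) ++ Q.actions) := by simp
    rw [e] at hfl ⊢
    refine ⟨_, _, rfl, ?_⟩
    have hy : y ∈ w.floor := hfl _ List.mem_cons_self
    have hflB := hfl.tail.left
    set t1 := max (t + w.dist p y) (r j) with ht1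
    have hle : t + w.dist p y ≤ t1 := le_max_left _ _
    have hft : finishTime κ w r t p
        (Action.pick (j, y) :: ((B.map Action.pick ++ [Action.close]) ++ Q.actions)) =
        finishTime κ w r (finishTime κ w r t1 y (B.map Action.pick ++ [Action.close]))
          (endPoint κ w y (B.map Action.pick ++ [Action.close])) Q.actions :=
      finishTime_append _ _ _ _
    have h1 := htail (finishTime κ w r t1 y (B.map Action.pick ++ [Action.close]))
      (endPoint_mem (κ := κ) hflB hy) (endPoint_close _ _)
    rw [hft]
    have hmem : ∀ x : Item n, x ∈ B →
        Action.pick x ∈ (B.map Action.pick ++ [Action.close] : List (Action n)) := by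
      intro x hx; simpa using hx
    obtain ⟨⟨hjA, hyF⟩, hjC⟩ := mem_pendingItems.1 (hS _ List.mem_cons_self)
    simp only at hjA hyF hjC
    rcases mem_stops.1 hyF with rfl | ⟨rfl, rfl⟩
    · refine Or.inl ⟨rfl, ?_⟩
      -- The picker is at `v`, here called `y`, and still has to reach `u`: the pushcart to close
      -- the batch, the robot for the other item of order `j`.
      have h2 : t1 + w.dist u y ≤ finishTime κ w r t1 y (B.map Action.pick ++ [Action.close]) := by
        cases κ
        · have := endPoint_dist_le_finishTime (κ := Cart.pushcart) (r := r) hflB t1 hy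
          rwa [endPoint_close _ _ rfl, ← hs.eq_depot rfl, Layout.dist_comm y u] at this
        · have h3 : (j, u) ∈ (j, y) :: B := h.mem_head (mem_pendingItems.2
            ⟨⟨hjA, by simp [stops]⟩, fun h => hs.ne h.2⟩)
            (Finset.mem_union_right _ (mem_ordersOf.2 ⟨y, List.mem_cons_self⟩))
          have h4 : (j, u) ∈ B := by
            rcases List.mem_cons.1 h3 with h3 | h3
            · exact absurd (Prod.ext_iff.1 h3).2 hs.ne
            · exact h3
          have := detour_le_finishTime (κ := Cart.robot) (r := r) hflB t1 hy (hmem _ h4)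
          have h5 := dist_nonneg (w := w.toLayout) u
            (endPoint Cart.robot w y (B.map Action.pick ++ [Action.close]))
          rw [Layout.dist_comm y u] at this
          simp only at this
          linarith
      linarith
    · refine Or.inr ⟨rfl, ?_⟩
      -- Only a robot has items at `u`. If the batch contains a new order, the walk to `v` for it
      -- costs as much as a further batch; the minimum with 1 records whether there is such an
      -- order.
      have h2 : t1 + w.dist y v * ((min (ordersOf ((j, y) :: B) \ C).card 1 : ℕ) : ℝ) ≤
          finishTime Cart.robot w r t1 y (B.map Action.pick ++ [Action.close]) := by
        rcases (ordersOf ((j, y) :: B) \ C).eq_empty_or_nonempty with h0 | ⟨o, ho⟩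
        · rw [h0]
          simpa using le_finishTime _ _
        · have h3 : min (ordersOf ((j, y) :: B) \ C).card 1 = 1 :=
            min_eq_right (Finset.card_pos.2 ⟨o, ho⟩)
          rw [h3]
          rw [Finset.mem_sdiff] at ho
          obtain ⟨x, hx⟩ := mem_ordersOf.1 ho.1
          have h4 : (o, v) ∈ (j, y) :: B := h.mem_head (mem_pendingItems.2
            ⟨⟨(mem_pendingItems.1 (hS _ hx)).1.1, right_mem_stops⟩, fun h => ho.2 h.1⟩)
            (Finset.mem_union_right _ ho.1)
          have h5 : (o, v) ∈ B := by
            rcases List.mem_cons.1 h4 with h4 | h4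
            · exact absurd (Prod.ext_iff.1 h4).2.symm hs.ne
            · exact h4
          have := detour_le_finishTime (κ := Cart.robot) (r := r) hflB t1 hy (hmem _ h5)
          have h6 := dist_nonneg (w := w.toLayout) v
            (endPoint Cart.robot w y (B.map Action.pick ++ [Action.close]))
          simp only at this
          push_cast
          linarith
      simp only [batchTime] at h1 ⊢
      push_cast [Nat.cast_add] at h2 ⊢
      linarith

end LowerBounds

/-! ### Optimal plans when all orders are alike -/

section Waves
variable {d K : ℕ} {κ : Cart} {w : Warehouse} {u v : Point}

/-- The first `m` of `n` orders. -/
def firstOrders (n m : ℕ) : Finset (Fin n) := Finset.univ.filter fun j => (j : ℕ) < m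

theorem mem_firstOrders {n m : ℕ} {j : Fin n} : j ∈ firstOrders n m ↔ (j : ℕ) < m := by
  simp [firstOrders]

theorem card_firstOrders {n m : ℕ} (h : m ≤ n) : (firstOrders n m).card = m := by
  rw [firstOrders, Fin.card_filter_val_lt, min_eq_right h]

/-- The `q`-th group of `d + 1` orders after the first `d` orders. -/
def group (n d q : ℕ) : Finset (Fin n) :=
  Finset.univ.filter fun j => d + (d + 1) * q ≤ j ∧ (j : ℕ) < d + (d + 1) * (q + 1)

theorem mem_group {n q : ℕ} {j : Fin n} :
    j ∈ group n d q ↔ d + (d + 1) * q ≤ j ∧ (j : ℕ) < d + (d + 1) * (q + 1) := by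
  simp [group]

theorem card_group_le (n d q : ℕ) : (group n d q).card ≤ d + 1 := by
  have : (group n d q).card ≤
      (Finset.Ico (d + (d + 1) * q) (d + (d + 1) * (q + 1))).card :=
    Finset.card_le_card_of_injOn (fun j => (j : ℕ))
      (fun j hj => by simpa using mem_group.1 hj) (fun i _ j _ h => Fin.ext h)
  rw [Nat.card_Ico, mul_add] at this
  omega

theorem group_nonempty {q : ℕ} (h : q < K) : (group (d + (d + 1) * K) d q).Nonempty := by
  have h1 : (d + 1) * (q + 1) ≤ (d + 1) * K := Nat.mul_le_mul_left _ h
  have h2 : (d + 1) * (q + 1) = (d + 1) * q + (d + 1) := by ring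
  exact ⟨⟨d + (d + 1) * q, by omega⟩, mem_group.2 ⟨le_rfl, by simp only; omega⟩⟩

theorem exists_mem_group_iff {n k : ℕ} {j : Fin n} :
    (∃ G ∈ (List.range k).map (group n d), j ∈ G) ↔ d ≤ j ∧ (j : ℕ) < d + (d + 1) * k := by
  simp only [List.mem_map, List.mem_range, exists_exists_and_eq_and, mem_group]
  constructor
  · rintro ⟨q, hq, h1, h2⟩
    have : (d + 1) * (q + 1) ≤ (d + 1) * k := Nat.mul_le_mul_left _ hq
    omega
  · rintro ⟨h1, h2⟩
    have h3 := Nat.div_add_mod ((j : ℕ) - d) (d + 1)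
    have h4 : ((j : ℕ) - d) % (d + 1) < d + 1 := Nat.mod_lt _ d.succ_pos
    refine ⟨((j : ℕ) - d) / (d + 1), Nat.div_lt_of_lt_mul (by omega), ?_, ?_⟩
    · omega
    · rw [mul_add]; omega

theorem pairwise_group (n d k : ℕ) : ((List.range k).map (group n d)).Pairwise Disjoint := by
  rw [List.pairwise_map]
  refine List.pairwise_lt_range.imp fun {p q} h => Finset.disjoint_left.2 fun j hp hq => ?_
  have h1 : (d + 1) * (p + 1) ≤ (d + 1) * q := Nat.mul_le_mul_left _ h
  have := mem_group.1 hp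
  have := mem_group.1 hq
  omega

/-- Upper bound: the first batch consists of the orders in `C ∪ Y`, those in `C` having been
commenced, and is followed by `k` full batches. -/
theorem exists_plan {r : Fin (d + (d + 1) * K) → ℝ} (hs : IsShuttle κ w u v) {k : ℕ} (hk : k ≤ K)
    {A C Y : Finset (Fin (d + (d + 1) * K))} (hCY : Disjoint C Y)
    (hA : ∀ j, j ∈ A ↔ j ∈ C ∪ Y ∨ d ≤ j ∧ (j : ℕ) < d + (d + 1) * k) (hne : (C ∪ Y).Nonempty)
    (hcard : (C ∪ Y).card ≤ d + 1)
    (hX : ∀ j ∈ C ∪ Y, ¬ (d ≤ j ∧ (j : ℕ) < d + (d + 1) * k)) {t : ℝ} (p : Point)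
    (hr : ∀ j ∈ C ∪ Y, r j ≤ t)
    (hr' : ∀ q < k, ∀ j ∈ group (d + (d + 1) * K) d q,
      r j ≤ t + firstTime w u v p Y + batchTime κ (w.dist u v) * q) :
    ∃ P, Plan.Feasible (d + 1) (pendingItems κ u v A C) C P ∧
      finishTime κ w r t p P.actions ≤
        t + firstTime w u v p Y + batchTime κ (w.dist u v) * k := by
  have hG : ∀ G ∈ (List.range k).map (group (d + (d + 1) * K) d), ∃ q < k, G = group _ d q := by
    intro G hG
    obtain ⟨q, hq, rfl⟩ := List.mem_map.1 hG
    exact ⟨q, List.mem_range.1 hq, rfl⟩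
  have hGne : ∀ G ∈ (List.range k).map (group (d + (d + 1) * K) d), G.Nonempty := by
    intro G h
    obtain ⟨q, hq, rfl⟩ := hG G h
    exact group_nonempty (hq.trans_le hk)
  refine ⟨firstBatch κ u v Y (C ∪ Y) :: sweeps κ u v ((List.range k).map (group _ d)),
    feasible_firstBatch hs.ne rfl ?_ ?_ ?_ ?_, ?_⟩
  · rintro ⟨j, y⟩
    have hj := exists_mem_group_iff (d := d) (k := k) (j := j)
    have h1 : (∃ G ∈ (List.range k).map (group (d + (d + 1) * K) d), j ∈ G ∧ y ∈ stops κ u v) ↔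
        (d ≤ j ∧ (j : ℕ) < d + (d + 1) * k) ∧ y ∈ stops κ u v := by
      rw [← hj]
      exact ⟨fun ⟨G, h, h', h''⟩ => ⟨⟨G, h, h'⟩, h''⟩, fun ⟨⟨G, h, h'⟩, h''⟩ => ⟨G, h, h', h''⟩⟩
    simp only
    rw [h1, mem_pendingItems, hA]
    simp only
    have h2 := hX j
    have h3 : j ∈ C → j ∉ Y := fun h => Finset.disjoint_left.1 hCY h
    rw [Finset.mem_union, mem_stops] at *
    have h4 := hs.ne
    constructor
    · rintro ⟨⟨ha, hy⟩, hn⟩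
      rcases ha with ha | ha
      · refine Or.inl ?_
        rcases hy with rfl | ⟨hκ, rfl⟩
        · exact Or.inl ⟨ha.resolve_left fun h => hn ⟨h, rfl⟩, rfl⟩
        · exact Or.inr ⟨hκ, ha, rfl⟩
      · exact Or.inr ⟨ha, hy⟩
    · rintro ((⟨h, rfl⟩ | ⟨hκ, h, rfl⟩) | ⟨h, hy⟩)
      · exact ⟨⟨Or.inl (Or.inr h), Or.inl rfl⟩, fun h' => h3 h'.1 h⟩
      · exact ⟨⟨Or.inl h, Or.inr ⟨hκ, rfl⟩⟩, fun h' => h4 h'.2⟩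
      · exact ⟨⟨Or.inr h, hy⟩, fun h' => h2 (Or.inl h'.1) h⟩
  · intro G h
    rcases List.mem_cons.1 h with rfl | h
    · exact hne
    · exact hGne G h
  · intro G h
    rcases List.mem_cons.1 h with rfl | h
    · exact hcard
    · obtain ⟨q, -, rfl⟩ := hG G h
      exact card_group_le _ d q
  · refine List.pairwise_cons.2 ⟨fun G h => Finset.disjoint_left.2 fun j hj hj' => ?_,
      pairwise_group _ d k⟩
    exact hX j hj (exists_mem_group_iff.1 ⟨G, h, hj'⟩)
  · have := finishTime_firstBatch hs hne Finset.subset_union_right hr p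
      ((List.range k).map (group _ d)) hGne (fun i hi j hj => by
        simp only [List.getElem_map, List.getElem_range] at hj
        exact hr' i (by simpa using hi) j hj)
    simpa using this

theorem batchTime_pos (hs : IsShuttle κ w u v) : 0 < batchTime κ (w.dist u v) := by
  have := hs.dist_pos
  cases κ
  · simp only [batchTime]; linarith
  · exact this

/-- The optimality of a plan among the feasible plans. -/
def Plan.Optimal {n : ℕ} (κ : Cart) (w : Warehouse) (r : Fin n → ℝ) (c : ℕ) (S : Finset (Item n))
    (C : Finset (Fin n)) (t : ℝ) (p : Point) (P : Plan n) : Prop :=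
  P.Feasible c S C ∧ ∀ Q : Plan n, Q.Feasible c S C →
    finishTime κ w r t p P.actions ≤ finishTime κ w r t p Q.actions

variable {r : Fin (d + (d + 1) * K) → ℝ}

/-- The commenced orders take d of the d + 1 bins, so at most one new order fits into the current
batch and the others need later ones. -/
theorem Plan.Feasible.card_pending {m : ℕ} (hm : m ≤ d + (d + 1) * K) (hdm : d ≤ m)
    {B : List (Item (d + (d + 1) * K))} {Q : Plan (d + (d + 1) * K)}
    (hf : Plan.Feasible (d + 1) (pendingItems κ u v (firstOrders _ m) (firstOrders _ d))
      (firstOrders _ d) (B :: Q)) :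
    m - d ≤ (ordersOf B \ firstOrders _ d).card + (d + 1) * Q.length ∧
      (ordersOf B \ firstOrders _ d).card ≤ 1 := by
  have h1 := hf.card_le (U := firstOrders _ m) fun j hj => by
    rw [Finset.mem_sdiff] at hj
    exact ⟨v, mem_pendingItems.2 ⟨⟨hj.1, right_mem_stops⟩, fun h => hj.2 h.1⟩⟩
  have h2 := hf.card_new_le
  have hsub : firstOrders (d + (d + 1) * K) d ⊆ firstOrders _ m := by
    intro j hj; rw [mem_firstOrders] at *; omega
  rw [Finset.card_sdiff_of_subset hsub, card_firstOrders hm, card_firstOrders (hdm.trans hm)] at h1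
  rw [card_firstOrders (hdm.trans hm)] at h2
  exact ⟨h1, by omega⟩

theorem firstTime_nonneg {n : ℕ} (p : Point) (Y : Finset (Fin n)) :
    0 ≤ firstTime w u v p Y := by
  have h1 := dist_nonneg (w := w.toLayout) p u
  have h2 := dist_nonneg (w := w.toLayout) p v
  have h3 := dist_nonneg (w := w.toLayout) u v
  rw [firstTime]
  split_ifs <;> linarith

/-- If the pending orders fill `k` batches, then the commenced batch is completed at once. -/
theorem Plan.Optimal.heads_left (hs : IsShuttle κ w u v) (hd : 1 ≤ d) {k : ℕ} (hk : k ≤ K) {t : ℝ}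
    (hr : ∀ j ∈ firstOrders _ (d + (d + 1) * k), r j ≤ t) {p : Point}
    (hp : w.dist p u < w.dist p v + w.dist u v) {P : Plan (d + (d + 1) * K)}
    (hP : P.Optimal κ w r (d + 1)
      (pendingItems κ u v (firstOrders _ (d + (d + 1) * k)) (firstOrders _ d))
      (firstOrders _ d) t p) :
    (∃ x l, P.actions = x :: l ∧ target κ w p x = u) ∧
      t + batchTime κ (w.dist u v) * k ≤ finishTime κ w r t p P.actions := by
  obtain ⟨hf, hopt⟩ := hP
  have hkK : (d + 1) * k ≤ (d + 1) * K := Nat.mul_le_mul_left _ hk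
  have hC : (firstOrders (d + (d + 1) * K) d).card = d := card_firstOrders (by omega)
  have hCne : (firstOrders (d + (d + 1) * K) d).Nonempty := Finset.card_pos.1 (by omega)
  have hCA : firstOrders (d + (d + 1) * K) d ⊆ firstOrders _ (d + (d + 1) * k) := by
    intro j hj; rw [mem_firstOrders] at *; omega
  have hl0 := batchTime_pos hs
  obtain ⟨P', h1, h2⟩ := exists_plan (r := r) hs hk (A := firstOrders _ (d + (d + 1) * k))
    (C := firstOrders _ d) (Y := ∅) (Finset.disjoint_empty_right _)
    (by intro j; simp only [Finset.union_empty, mem_firstOrders]; omega)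
    (by simpa using hCne) (by simp [hC])
    (by intro j; simp only [Finset.union_empty, mem_firstOrders]; omega) (t := t) p
    (by intro j hj; exact hr j (hCA (by simpa using hj)))
    (by
      intro q hq j hj
      have h3 := (exists_mem_group_iff (d := d) (k := k) (j := j)).1
        ⟨_, List.mem_map_of_mem (List.mem_range.2 hq), hj⟩
      have h4 := hr j (mem_firstOrders.2 h3.2)
      have h5 := firstTime_nonneg (w := w) (u := u) (v := v) p
        (∅ : Finset (Fin (d + (d + 1) * K)))
      have : 0 ≤ batchTime κ (w.dist u v) * (q : ℝ) := by positivity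
      linarith)
  have h3 := (hopt P' h1).trans h2
  simp only [firstTime, if_true] at h3
  cases P with
  | nil => exact absurd rfl (hf.ne_nil hCne)
  | cons B Q =>
    obtain ⟨h4, h5⟩ := hf.card_pending (by omega) (by omega)
    -- One free bin does not replace a batch of d + 1 ≥ 2 orders; here d ≥ 1 is essential.
    have h6 : k ≤ Q.length := by
      by_contra! h
      have : (d + 1) * (Q.length + 1) ≤ (d + 1) * k := Nat.mul_le_mul_left _ h
      rw [mul_add] at this
      omega
    have h7 : batchTime κ (w.dist u v) * k ≤ batchTime κ (w.dist u v) * Q.length :=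
      mul_le_mul_of_nonneg_left (by exact_mod_cast h6) hl0.le
    obtain ⟨x, l, hx, h | h⟩ := hf.first_move (r := r) hs hCA t p
    · linarith [h.2]
    · refine ⟨⟨x, l, hx, h.1⟩, le_trans ?_ h.2⟩
      have h8 := dist_nonneg (w := w.toLayout) p u
      have h9 : batchTime κ (w.dist u v) * Q.length ≤ batchTime κ (w.dist u v) *
          ((Q.length + min (ordersOf B \ firstOrders _ d).card 1 : ℕ) : ℝ) :=
        mul_le_mul_of_nonneg_left (by exact_mod_cast Nat.le_add_right _ _) hl0.le
      linarith

/-- If the pending orders fill `k` batches and one order is left over, then the latter is put into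
the free bin. -/
theorem Plan.Optimal.heads_right (hs : IsShuttle κ w u v) (hd : 1 ≤ d) {k : ℕ} (hk : k < K) {t : ℝ}
    (hr : ∀ j ∈ firstOrders _ (d + (d + 1) * k + 1), r j ≤ t) {p : Point}
    (hp : w.dist p v + w.dist u v < w.dist p u + batchTime κ (w.dist u v))
    {P : Plan (d + (d + 1) * K)}
    (hP : P.Optimal κ w r (d + 1)
      (pendingItems κ u v (firstOrders _ (d + (d + 1) * k + 1)) (firstOrders _ d))
      (firstOrders _ d) t p) :
    ∃ x l, P.actions = x :: l ∧ target κ w p x = v := by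
  obtain ⟨hf, hopt⟩ := hP
  have hkK : (d + 1) * (k + 1) ≤ (d + 1) * K := Nat.mul_le_mul_left _ hk
  rw [mul_add] at hkK
  have hC : (firstOrders (d + (d + 1) * K) d).card = d := card_firstOrders (by omega)
  have hCne : (firstOrders (d + (d + 1) * K) d).Nonempty := Finset.card_pos.1 (by omega)
  have hCA : firstOrders (d + (d + 1) * K) d ⊆ firstOrders _ (d + (d + 1) * k + 1) := by
    intro j hj; rw [mem_firstOrders] at *; omega
  have hl0 := batchTime_pos hs
  set o : Fin (d + (d + 1) * K) := ⟨d + (d + 1) * k, by omega⟩ with ho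
  have hmem : ∀ j, j ∈ firstOrders (d + (d + 1) * K) d ∪ {o} ↔
      (j : ℕ) < d ∨ (j : ℕ) = d + (d + 1) * k := by
    intro j
    rw [Finset.mem_union, mem_firstOrders, Finset.mem_singleton, ho, Fin.ext_iff]
  obtain ⟨P', h1, h2⟩ := exists_plan (r := r) hs hk.le (A := firstOrders _ (d + (d + 1) * k + 1))
    (C := firstOrders _ d) (Y := {o})
    (by rw [Finset.disjoint_singleton_right, mem_firstOrders, ho]; simp only; omega)
    (by intro j; rw [hmem, mem_firstOrders]; omega)
    (hCne.mono Finset.subset_union_left)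
    ((Finset.card_union_le _ _).trans (by rw [hC, Finset.card_singleton]))
    (by intro j; rw [hmem]; omega) (t := t) p
    (by intro j hj; rw [hmem] at hj; exact hr j (mem_firstOrders.2 (by omega)))
    (by
      intro q hq j hj
      have h3 := (exists_mem_group_iff (d := d) (k := k) (j := j)).1
        ⟨_, List.mem_map_of_mem (List.mem_range.2 hq), hj⟩
      have h4 := hr j (mem_firstOrders.2 (by omega))
      have h5 := firstTime_nonneg (w := w) (u := u) (v := v) p {o}
      have : 0 ≤ batchTime κ (w.dist u v) * (q : ℝ) := by positivity
      linarith)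
  have h3 := (hopt P' h1).trans h2
  simp only [firstTime, Finset.singleton_ne_empty, if_false] at h3
  cases P with
  | nil => exact absurd rfl (hf.ne_nil hCne)
  | cons B Q =>
    obtain ⟨h4, h5⟩ := hf.card_pending (by omega) (by omega)
    obtain ⟨x, l, hx, h | h⟩ := hf.first_move (r := r) hs hCA t p
    · exact ⟨x, l, hx, h.1⟩
    -- If the free bin stays empty, the (d + 1)k + 1 new orders need k + 1 later batches. If it is
    -- filled, k later batches are still needed, and coming back from `u` for the added order costs
    -- one more `batchTime`. Either way this exceeds the plan via `v`.
    · have h6 : k + 1 ≤ Q.length + min (ordersOf B \ firstOrders _ d).card 1 := by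
        rw [min_eq_left h5]
        by_contra! h
        rcases Nat.le_one_iff_eq_zero_or_eq_one.1 h5 with h0 | h0 <;> rw [h0] at h h4
        · have : (d + 1) * Q.length ≤ (d + 1) * k := Nat.mul_le_mul_left _ (by omega)
          omega
        · have : (d + 1) * (Q.length + 1) ≤ (d + 1) * k := Nat.mul_le_mul_left _ (by omega)
          rw [mul_add] at this
          omega
      have h7 : batchTime κ (w.dist u v) * ((k + 1 : ℕ) : ℝ) ≤ batchTime κ (w.dist u v) *
          ((Q.length + min (ordersOf B \ firstOrders _ d).card 1 : ℕ) : ℝ) :=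
        mul_le_mul_of_nonneg_left (by exact_mod_cast h6) hl0.le
      have h8 := h.2
      push_cast at h7 h8
      linarith

end Waves

/-! ### The start -/

section Start
variable {d K : ℕ} {κ : Cart} {w : Warehouse} {u v : Point}

theorem endPoint_visit {n : ℕ} {L : List (Item n)} (hL : L ≠ []) (hv : ∀ y ∈ L, y.2 = v)
    (p : Point) : endPoint κ w p (L.map Action.pick) = v := by
  obtain ⟨L', y, rfl⟩ := (List.eq_nil_or_concat L).resolve_left hL
  simp [endPoint, List.foldl_append, target, hv y (by simp)]

theorem exists_split {n : ℕ} (v : Point) (B : List (Item n)) : ∃ L R, B = L ++ R ∧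
    (∀ y ∈ L, y.2 = v) ∧ ∀ z R', R = z :: R' → z.2 ≠ v := by
  induction B with
  | nil => exact ⟨[], [], rfl, by simp, by simp⟩
  | cons x B ih =>
    by_cases hx : x.2 = v
    · obtain ⟨L, R, rfl, h1, h2⟩ := ih
      refine ⟨x :: L, R, rfl, ?_, h2⟩
      intro y hy
      rcases List.mem_cons.1 hy with rfl | hy
      · exact hx
      · exact h1 y hy
    · refine ⟨[], x :: B, rfl, by simp, ?_⟩
      rintro z R' h
      obtain ⟨rfl, -⟩ := List.cons_eq_cons.1 h
      exact hx

variable {r : Fin (d + (d + 1) * K) → ℝ}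

/-- The first `d` orders are put into one batch, and they are commenced at `v`. -/
theorem Plan.Optimal.start (hs : IsShuttle κ w u v) (hd : 1 ≤ d)
    (hr : ∀ j ∈ firstOrders (d + (d + 1) * K) d, r j ≤ 0) {P : Plan (d + (d + 1) * K)}
    (hP : P.Optimal κ w r (d + 1) (pendingItems κ u v (firstOrders _ d) ∅) ∅ 0 w.depot) :
    ∃ L x l, P.actions = L.map Action.pick ++ x :: l ∧ L ≠ [] ∧
      (∀ y : Item (d + (d + 1) * K), y ∈ L ↔ y.1 ∈ firstOrders _ d ∧ y.2 = v) ∧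
      ∀ p, target κ w p x = u := by
  obtain ⟨hf, hopt⟩ := hP
  have hC : (firstOrders (d + (d + 1) * K) d).card = d := card_firstOrders (by omega)
  have hCne : (firstOrders (d + (d + 1) * K) d).Nonempty := Finset.card_pos.1 (by omega)
  obtain ⟨o, ho⟩ := hCne
  have hl0 := batchTime_pos hs
  have hD := hs.dist_pos
  obtain ⟨P', h1, h2⟩ := exists_plan (r := r) hs (Nat.zero_le K) (A := firstOrders _ d)
    (C := ∅) (Y := firstOrders _ d) (Finset.disjoint_empty_left _)
    (by intro j; simp only [Finset.empty_union, mem_firstOrders]; omega)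
    (by simpa using ⟨o, ho⟩) (by simp [hC])
    (by intro j; simp only [Finset.empty_union, mem_firstOrders]; omega) (t := 0) w.depot
    (by intro j hj; exact hr j (by simpa using hj)) (by intro q hq; omega)
  have h3 := (hopt P' h1).trans h2
  simp only [firstTime, Finset.ne_empty_of_mem ho, if_false, zero_add, CharP.cast_eq_zero,
    mul_zero, add_zero] at h3
  have hmemS : ∀ y, y ∈ stops κ u v → (o, y) ∈ pendingItems κ u v (firstOrders _ d) ∅ :=
    fun y hy => mem_pendingItems.2 ⟨⟨ho, hy⟩, by simp⟩
  cases P with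
  | nil =>
    have := hf.mem_iff.2 (hmemS v right_mem_stops)
    simp at this
  | cons B Q =>
    obtain ⟨i, hi⟩ := hf.batch_nonempty (∅ ∪ ordersOf B) (by simp [Plan.batches])
    rw [Finset.empty_union] at hi
    obtain ⟨x, l, hx, h | h⟩ := hf.first_move (r := r) hs (Finset.empty_subset _) 0 w.depot
    -- The bound attained with a single batch leaves no time for a second one.
    · have hQ : Q = [] := by
        by_contra hQ
        have : 1 ≤ Q.length := List.length_pos_iff.2 hQ
        have : batchTime κ (w.dist u v) * 1 ≤ batchTime κ (w.dist u v) * Q.length :=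
          mul_le_mul_of_nonneg_left (by exact_mod_cast this) hl0.le
        linarith [h.2]
      subst hQ
      have hB : ∀ y, y ∈ B ↔ y ∈ pendingItems κ u v (firstOrders _ d) ∅ := by
        intro y
        rw [← hf.mem_iff]
        simp
      have hBne : B ≠ [] := by
        rintro rfl
        simp [ordersOf] at hi
      have hact : Plan.actions [B] = B.map Action.pick ++ [Action.close] := by
        simp [Plan.actions]
      have hfl : OnFloor w (Plan.actions [B]) :=
        hf.onFloor fun x hx => hs.mem_floor_of_pending hx
      cases κ
      · refine ⟨B, Action.close, [], hact, hBne, fun y => ?_, fun p => (hs.eq_depot rfl).symm⟩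
        rw [hB, mem_pendingItems]
        simp [stops]
      · obtain ⟨L, R, rfl, hL, hR⟩ := exists_split v B
        have hou : (o, u) ∈ L ++ R := (hB _).2 (hmemS u (by simp [stops]))
        cases R with
        | nil =>
          rw [List.append_nil] at hou
          exact absurd (hL _ hou) hs.ne
        | cons z R =>
          have hzv := hR z R rfl
          have hzu : z.2 = u := by
            have := (mem_pendingItems.1 ((hB z).1 (by simp))).1.2
            rcases mem_stops.1 this with h | h
            · exact absurd h hzv
            · exact h.2
          have hact' : Plan.actions [L ++ z :: R] =
              L.map Action.pick ++ Action.pick z :: (R.map Action.pick ++ [Action.close]) := by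
            rw [hact]; simp
          have hLne : L ≠ [] := by
            rintro rfl
            rw [hact', List.map_nil, List.nil_append] at hx
            obtain ⟨rfl, -⟩ := List.cons_eq_cons.1 hx
            exact hzv h.1
          refine ⟨L, Action.pick z, _, hact', hLne, fun y => ⟨fun hy => ?_, fun hy => ?_⟩,
            fun p => hzu⟩
          · exact ⟨(mem_pendingItems.1 ((hB y).1 (List.mem_append_left _ hy))).1.1, hL y hy⟩
          · have : y ∈ L ++ z :: R :=
              (hB y).2 (mem_pendingItems.2 ⟨⟨hy.1, hy.2 ▸ right_mem_stops⟩, by simp⟩)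
            rcases List.mem_append.1 this with h' | h'
            · exact h'
            exfalso
            rcases List.mem_cons.1 h' with rfl | h'
            · exact hzv hy.2
            -- An item at `v` picked after the visit to `u` would mean walking from `v` to `u` and
            -- back, 2D instead of D.
            rw [hact', finishTime_append, endPoint_visit hLne hL] at h3
            rw [hact'] at hfl
            have a1 := endPoint_dist_le_finishTime (κ := Cart.robot) (r := r) hfl.left 0 w.depot_mem
            rw [endPoint_visit hLne hL] at a1
            rw [finishTime] at h3
            simp only [target] at h3
            rw [hzu] at h3
            have a2 := detour_le_finishTime (κ := Cart.robot) (r := r) hfl.right.tail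
              (max (finishTime Cart.robot w r 0 w.depot (L.map Action.pick) + w.dist v u)
                (release r (finishTime Cart.robot w r 0 w.depot (L.map Action.pick))
                  (Action.pick z))) hs.left_mem (x := y) (by simp [h'])
            have a3 := le_max_left
              (finishTime Cart.robot w r 0 w.depot (L.map Action.pick) + w.dist v u)
                (release r (finishTime Cart.robot w r 0 w.depot (L.map Action.pick))
                  (Action.pick z))
            have a4 := dist_nonneg (w := w.toLayout) y.2
              (endPoint Cart.robot w u (R.map Action.pick ++ [Action.close]))
            rw [hy.2] at a2 a4
            rw [Layout.dist_comm v u] at h3 a2 a3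
            linarith
    -- Going to `u` first is impossible for the pushcart, whose items are all at `v`, and too long
    -- for the robot, because `v` is closer to the depot.
    · exfalso
      have h4 := h.2
      rw [min_eq_right (Finset.card_pos.2 ⟨i, by simpa using hi⟩)] at h4
      have h5 : batchTime κ (w.dist u v) * 1 ≤
          batchTime κ (w.dist u v) * ((Q.length + 1 : ℕ) : ℝ) :=
        mul_le_mul_of_nonneg_left (by exact_mod_cast Nat.le_add_left 1 _) hl0.le
      cases κ
      · cases B with
        | nil => simp [ordersOf] at hi
        | cons z B =>
          rw [Plan.actions_cons, List.map_cons, List.cons_append] at hx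
          obtain ⟨rfl, -⟩ := List.cons_eq_cons.1 hx
          have hz := (mem_pendingItems.1 ((hf.mem_iff (x := z)).1 (by simp))).1.2
          simp only [stops, Finset.mem_singleton] at hz
          exact hs.ne (h.1.symm.trans hz)
      · have := hs.closer rfl
        simp only [batchTime] at h4 h5
        linarith

end Start

/-! ### Following a plan -/

namespace Instance
variable {κ : Cart} {w : Warehouse} {I : Instance w} {u v : Point}

theorem Exec.of_lt {s s' : I.State} {x : Action I.n} {l : List (Action I.n)} {τ : ℝ}
    (h : I.Exec κ s (x :: l) τ s') (hτ : τ < w.dist s.pos (target κ w s.pos x)) :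
    ∃ y ∈ w.floor, w.dist s.pos y = τ ∧
      w.dist y (target κ w s.pos x) = w.dist s.pos (target κ w s.pos x) - τ ∧
      s' = ⟨y, s.picked, s.cart⟩ := by
  cases h with
  | underway _ _ _ _ y _ hy h1 h2 => exact ⟨y, hy, h1, h2, rfl⟩
  | step _ _ _ _ _ h' => exact absurd hτ h'.not_gt

theorem Exec.of_le {s s' : I.State} {x : Action I.n} {l : List (Action I.n)} {τ : ℝ}
    (h : I.Exec κ s (x :: l) τ s') (hτ : w.dist s.pos (target κ w s.pos x) ≤ τ) :
    I.Exec κ (I.perform κ s x) l (τ - w.dist s.pos (target κ w s.pos x)) s' := by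
  cases h with
  | underway _ _ _ _ y h' => exact absurd hτ h'.not_ge
  | step _ _ _ _ _ _ h => exact h

/-- Picks on the spot take no time, so all of `σ` is spent on the way to `u`. The position reached
is known only by its distances, since shortest paths need not be unique. -/
theorem Exec.stay (hv : v ∈ w.floor) {x : Action I.n} (hx : ∀ p, target κ w p x = u)
    {l : List (Action I.n)} {σ : ℝ} (h0 : 0 ≤ σ) (hσ : σ < w.dist v u) (L : List (Item I.n)) :
    ∀ {s s' : I.State}, (∀ y ∈ L, y.2 = v) → s.pos = v →
      I.Exec κ s (L.map Action.pick ++ x :: l) σ s' →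
      ∃ y ∈ w.floor, w.dist v y = σ ∧ w.dist y u = w.dist v u - σ ∧
        s' = ⟨y, s.picked ∪ L.toFinset, s.cart ∪ ordersOf L⟩ := by
  induction L with
  | nil =>
    intro s s' _ hs h
    obtain ⟨y, hy, h1, h2, h3⟩ := h.of_lt (by rwa [hx, hs])
    rw [hx, hs] at h2
    rw [hs] at h1
    exact ⟨y, hy, h1, h2, by simpa [ordersOf] using h3⟩
  | cons z L ih =>
    intro s s' hL hs h
    have hz : target κ w s.pos (Action.pick z : Action I.n) = v := hL z List.mem_cons_self
    have e : w.dist s.pos (target κ w s.pos (Action.pick z : Action I.n)) = 0 := by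
      rw [hz, hs, dist_self hv]
    have h' := Exec.of_le h (by rw [e]; exact h0)
    rw [e, sub_zero] at h'
    obtain ⟨y, hy, h1, h2, h3⟩ := ih (fun y hy => hL y (List.mem_cons_of_mem _ hy)) hz h'
    refine ⟨y, hy, h1, h2, h3.trans ?_⟩
    simp only [perform, State.mk.injEq, true_and]
    constructor
    · ext a; simp
    · ext a; simp [ordersOf]

theorem Exec.visit (hv : v ∈ w.floor) {x : Action I.n} (hx : ∀ p, target κ w p x = u)
    {l : List (Action I.n)} {σ : ℝ} (h0 : 0 ≤ σ) (hσ : σ < w.dist v u) {L : List (Item I.n)}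
    (hL : ∀ y ∈ L, y.2 = v) (hne : L ≠ []) {s s' : I.State}
    (h : I.Exec κ s (L.map Action.pick ++ x :: l) (w.dist s.pos v + σ) s') :
    ∃ y ∈ w.floor, w.dist v y = σ ∧ w.dist y u = w.dist v u - σ ∧
      s' = ⟨y, s.picked ∪ L.toFinset, s.cart ∪ ordersOf L⟩ := by
  cases L with
  | nil => exact absurd rfl hne
  | cons z L =>
    have hz : target κ w s.pos (Action.pick z : Action I.n) = v := hL z List.mem_cons_self
    have h' := Exec.of_le h (by rw [hz]; linarith)
    rw [hz, add_sub_cancel_left] at h'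
    obtain ⟨y, hy, h1, h2, h3⟩ := Exec.stay hv hx h0 hσ L
      (fun y hy => hL y (List.mem_cons_of_mem _ hy)) hz h'
    refine ⟨y, hy, h1, h2, h3.trans ?_⟩
    simp only [perform, State.mk.injEq, true_and]
    constructor
    · ext a; simp
    · ext a; simp [ordersOf]

end Instance

/-! ### The instances -/

/-- The index of the arrival time of the `j`-th order: first come `d` orders, then alternately one
order and `d` orders. -/
def wave (d j : ℕ) : ℕ :=
  if j < d then 0 else 2 * ((j - d) / (d + 1)) + if (j - d) % (d + 1) = 0 then 1 else 2

/-- There are two arrivals per group, so index `i` completes `i / 2` groups; an odd `i` has also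
brought the first order of the next one. -/
theorem wave_le_iff (d j i : ℕ) : wave d j ≤ i ↔ j < d + (d + 1) * (i / 2) + i % 2 := by
  rw [wave]
  split_ifs with h1 h2
  · exact ⟨fun _ => by omega, fun _ => Nat.zero_le _⟩
  all_goals
    have h3 := Nat.div_add_mod (j - d) (d + 1)
    have h4 : (j - d) % (d + 1) < d + 1 := Nat.mod_lt _ d.succ_pos
    set q := (j - d) / (d + 1)
    set k := i / 2 with hk
    have hi := Nat.div_add_mod i 2
    rw [← hk] at hi
    rcases lt_trichotomy q k with h | h | h
    · have : (d + 1) * (q + 1) ≤ (d + 1) * k := Nat.mul_le_mul_left _ h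
      rw [mul_add] at this
      constructor <;> intro <;> omega
    · rw [h] at h3 ⊢
      constructor <;> intro <;> omega
    · have : (d + 1) * (k + 1) ≤ (d + 1) * q := Nat.mul_le_mul_left _ h
      rw [mul_add] at this
      constructor <;> intro <;> omega

/-- The `i`-th arrival time: after time `0` and time `t₀` comes one in every `δ` time units. -/
def waveTime (t₀ δ : ℝ) (i : ℕ) : ℝ := if i = 0 then 0 else t₀ + ((i : ℝ) - 1) * δ

theorem waveTime_strictMono {t₀ δ : ℝ} (ht : 0 < t₀) (hδ : 0 < δ) : StrictMono (waveTime t₀ δ) := by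
  refine strictMono_nat_of_lt_succ fun i => ?_
  rw [waveTime, waveTime, if_neg i.succ_ne_zero]
  push_cast
  split_ifs with h
  · subst h
    simpa using ht
  · linarith

section
variable {κ : Cart} {w : Warehouse} {u v : Point} {t₀ δ : ℝ}

/-- An instance in which all orders have items at the same places. -/
abbrev waves (hF : ↑(stops κ u v) ⊆ w.pickingLocations) (d K : ℕ) (ht : 0 < t₀) (hδ : 0 < δ) :
    Instance w where
  n := d + (d + 1) * K
  order _ := stops κ u v
  order_nonempty _ := ⟨v, right_mem_stops⟩
  order_subset _ := hF
  arrival j := waveTime t₀ δ (wave d j)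
  arrival_nonneg j := by
    have := (waveTime_strictMono ht hδ).monotone (Nat.zero_le (wave d j))
    simpa [waveTime] using this
  arrival_mono i j h := by
    refine (waveTime_strictMono ht hδ).monotone ?_
    have := (wave_le_iff d j _).1 le_rfl
    exact (wave_le_iff d i _).2 (lt_of_le_of_lt (Fin.le_def.1 h) this)

variable (hF : ↑(stops κ u v) ⊆ w.pickingLocations) (d K : ℕ) (ht : 0 < t₀) (hδ : 0 < δ)

theorem waves_arrival_le {i : ℕ} (j : Fin (waves hF d K ht hδ).n) :
    (waves hF d K ht hδ).arrival j ≤ waveTime t₀ δ i ↔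
      j ∈ firstOrders (d + (d + 1) * K) (d + (d + 1) * (i / 2) + i % 2) := by
  rw [mem_firstOrders, ← wave_le_iff]
  exact (waveTime_strictMono ht hδ).le_iff_le

theorem waves_arrived (i : ℕ) : (waves hF d K ht hδ).arrived (waveTime t₀ δ i) =
    firstOrders (d + (d + 1) * K) (d + (d + 1) * (i / 2) + i % 2) ×ˢ stops κ u v := by
  ext ⟨j, y⟩
  simp only [Instance.arrived, Finset.mem_biUnion, Finset.mem_filter, Finset.mem_univ, true_and,
    Finset.mem_image, Prod.mk.injEq, Finset.mem_product]
  rw [← waves_arrival_le hF d K ht hδ]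
  constructor
  · rintro ⟨_, h, _, h', rfl, rfl⟩
    exact ⟨h, h'⟩
  · rintro ⟨h, h'⟩
    exact ⟨j, h, y, h', rfl, rfl⟩

theorem waves_items : (waves hF d K ht hδ).items =
    pendingItems κ u v (firstOrders (d + (d + 1) * K) (d + (d + 1) * K)) ∅ := by
  ext ⟨j, y⟩
  rw [mem_pendingItems, mem_firstOrders]
  simp only [Instance.items, Finset.mem_biUnion, Finset.mem_univ, true_and,
    Finset.mem_image, Prod.mk.injEq]
  constructor
  · rintro ⟨_, _, h', rfl, rfl⟩
    exact ⟨⟨Fin.is_lt _, h'⟩, by simp⟩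
  · rintro ⟨⟨-, h'⟩, -⟩
    exact ⟨j, y, h', rfl, rfl⟩

/-- Because d ≥ 1, no wave is empty, and each of the 2K + 1 times is indeed an arrival time. -/
theorem waves_arrivalTimes (hd : 1 ≤ d) : (waves hF d K ht hδ).arrivalTimes =
    (List.range' 0 (2 * K + 1)).map (waveTime t₀ δ) := by
  have hmono := waveTime_strictMono ht hδ
  have hp : ((List.range' 0 (2 * K + 1)).map (waveTime t₀ δ)).Pairwise (· < ·) := by
    rw [List.pairwise_map, ← List.range_eq_range']
    exact List.pairwise_lt_range.imp fun h => hmono h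
  have e : Finset.univ.image (waves hF d K ht hδ).arrival =
      ((List.range' 0 (2 * K + 1)).map (waveTime t₀ δ)).toFinset := by
    ext x
    rw [← List.range_eq_range']
    simp only [Finset.mem_image, Finset.mem_univ, true_and, List.mem_toFinset, List.mem_map,
      List.mem_range]
    constructor
    · rintro ⟨j, rfl⟩
      refine ⟨wave d j, ?_, rfl⟩
      have h : wave d j ≤ 2 * K := by
        rw [wave_le_iff, Nat.mul_div_cancel_left _ two_pos, Nat.mul_mod_right]
        exact j.2
      omega
    · rintro ⟨i, hi, rfl⟩
      have key : ∃ j, j < d + (d + 1) * K ∧ wave d j = i := by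
        rcases Nat.eq_zero_or_pos i with rfl | h0
        · exact ⟨0, by omega, by simp [wave, show 0 < d from hd]⟩
        have hm := Nat.div_add_mod (i - 1) 2
        have hm' := Nat.mod_lt (i - 1) two_pos
        have : (d + 1) * ((i - 1) / 2 + 1) ≤ (d + 1) * K := Nat.mul_le_mul_left _ (by omega)
        rw [mul_add] at this
        refine ⟨d + (d + 1) * ((i - 1) / 2) + (i - 1) % 2, by omega, ?_⟩
        have h1 : d + (d + 1) * ((i - 1) / 2) + (i - 1) % 2 - d =
          (d + 1) * ((i - 1) / 2) + (i - 1) % 2 := by omega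
        have h2 : (i - 1) % 2 < d + 1 := by omega
        rw [wave, if_neg (by omega), h1, Nat.mul_add_div d.succ_pos, Nat.mul_add_mod,
          Nat.div_eq_of_lt h2, Nat.mod_eq_of_lt h2]
        split_ifs <;> omega
      obtain ⟨j, hj, h⟩ := key
      exact ⟨⟨j, hj⟩, by rw [← h]⟩
  rw [Instance.arrivalTimes, e, List.toFinset_sort]
  · exact hp.imp le_of_lt
  · exact hp.imp ne_of_lt

theorem waves_optimal {t : ℝ} {s : (waves hF d K ht hδ).State} {P : Plan (d + (d + 1) * K)} {c : ℕ}
    {S : Finset (Item (d + (d + 1) * K))} {C : Finset (Fin (d + (d + 1) * K))}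
    (h : (waves hF d K ht hδ).IsOptimalPlan κ c t s P)
    (hS : (waves hF d K ht hδ).arrived t \ s.picked = S) (hC : s.cart = C) :
    P.Optimal κ w (waves hF d K ht hδ).arrival c S C t s.pos := by
  subst hS hC
  exact h

/-- The picker is on a shortest path between `u` and `v`, at distance `σ` from `v`, and has
commenced the first `d` orders. -/
structure OnTheWay (s : (waves hF d K ht hδ).State) (σ : ℝ) : Prop where
  pos_mem : s.pos ∈ w.floor
  dist_right : w.dist s.pos v = σ
  dist_left : w.dist s.pos u = w.dist u v - σ
  picked : s.picked = firstOrders (d + (d + 1) * K) d ×ˢ {v}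
  cart : s.cart = firstOrders (d + (d + 1) * K) d

theorem waves_pending {s : (waves hF d K ht hδ).State} {σ : ℝ} (h : OnTheWay hF d K ht hδ s σ)
    (i : ℕ) : (waves hF d K ht hδ).arrived (waveTime t₀ δ i) \ s.picked =
      pendingItems κ u v (firstOrders (d + (d + 1) * K) (d + (d + 1) * (i / 2) + i % 2))
        (firstOrders _ d) := by
  rw [waves_arrived, h.picked]
  rfl

/-- The start is put off until time λ = `batchTime`, a loss independent of `K`. Group `q` is
complete at time t₀ + (2q + 1)δ, at most λ(q + 1) plus the distance from the depot to `v`, and its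
batch begins later than that. By monotonicity the same plan started at time 0 ends no later. -/
theorem waves_ciopt_le (hs : IsShuttle κ w u v) (hd : 1 ≤ d)
    (h₀ : t₀ ≤ w.dist w.depot v + batchTime κ (w.dist u v) / 2)
    (h₁ : δ ≤ batchTime κ (w.dist u v) / 2) : (waves hF d K ht hδ).ciopt κ (d + 1) ≤
      batchTime κ (w.dist u v) + (w.dist w.depot v + w.dist u v) +
        batchTime κ (w.dist u v) * K := by
  have hl := batchTime_pos hs
  have hCne : (firstOrders (d + (d + 1) * K) d).Nonempty :=
    Finset.card_pos.1 (by rw [card_firstOrders (by omega)]; omega)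
  have hfirst : firstTime w u v w.depot (firstOrders (d + (d + 1) * K) d) =
      w.dist w.depot v + w.dist u v := by
    rw [firstTime, if_neg hCne.ne_empty]
  obtain ⟨P, h1, h2⟩ := exists_plan (r := (waves hF d K ht hδ).arrival) hs le_rfl
    (A := firstOrders _ (d + (d + 1) * K))
    (C := ∅) (Y := firstOrders _ d) (Finset.disjoint_empty_left _)
    (by intro j; have := j.2; simp only [Finset.empty_union, mem_firstOrders]; omega)
    (by simpa using hCne) (by simp [card_firstOrders])
    (by intro j; simp only [Finset.empty_union, mem_firstOrders]; omega)
    (t := batchTime κ (w.dist u v)) w.depot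
    (by
      intro j hj
      refine le_trans ((waves_arrival_le hF d K ht hδ (i := 0) j).2 (by simpa using hj)) ?_
      simpa [waveTime] using hl.le)
    (by
      intro q hq j hj
      have h3 : j ∈ firstOrders (d + (d + 1) * K)
          (d + (d + 1) * ((2 * q + 2) / 2) + (2 * q + 2) % 2) := by
        rw [mem_group] at hj
        rw [mem_firstOrders, show (2 * q + 2) / 2 = q + 1 by omega,
          show (2 * q + 2) % 2 = 0 by omega]
        exact hj.2
      refine le_trans ((waves_arrival_le hF d K ht hδ j).2 h3) ?_
      rw [hfirst, waveTime, if_neg (by omega)]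
      have h4 := hs.dist_pos
      push_cast
      have h5 : (2 * (q : ℝ) + 2 - 1) * δ ≤ (2 * (q : ℝ) + 2 - 1) * (batchTime κ (w.dist u v) / 2) :=
        mul_le_mul_of_nonneg_left h₁ (by have : (0 : ℝ) ≤ q := q.cast_nonneg; linarith)
      linarith)
  rw [hfirst] at h2
  obtain ⟨-, -, -, hle⟩ := (waves hF d K ht hδ).exists_ciopt κ (c := d + 1) (by omega)
  have h3 := hle P (by rw [waves_items]; exact h1)
  have h4 := finishTime_mono (κ := κ) (w := w) (r := (waves hF d K ht hδ).arrival) P.actions hl.le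
    w.depot
  exact h3.trans (h4.trans h2)

/-! ### The oscillation of the reoptimizing picker -/

variable {ε : ℝ}

/-- Reoptimization makes the picker oscillate without picking anything. -/
theorem waves_reoptFrom (hs : IsShuttle κ w u v) (hd : 1 ≤ d) (hε : 0 < ε)
    (hδε : δ + 2 * ε = batchTime κ (w.dist u v) / 2) {z : ℝ} : ∀ (m i : ℕ)
    (s : (waves hF d K ht hδ).State), 1 ≤ i → i + m = 2 * K →
    OnTheWay hF d K ht hδ s (if i % 2 = 1 then δ + ε else ε) →
    (waves hF d K ht hδ).ReoptFrom κ (d + 1) ((List.range' i (m + 1)).map (waveTime t₀ δ)) s z →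
    waveTime t₀ δ (2 * K) + batchTime κ (w.dist u v) * K ≤ z := by
  -- Hence δ + ε is less than the distance of `u` and `v`: the oscillation stays strictly between
  -- them, and neither is reached before the next arrival.
  have hlam : batchTime κ (w.dist u v) / 2 ≤ w.dist u v := by
    have := hs.dist_pos
    cases κ <;> simp only [batchTime] <;> linarith
  intro m
  induction m with
  | zero =>
    intro i s h1 hi hway h
    obtain rfl : i = 2 * K := hi
    obtain ⟨P, hP, rfl⟩ := h
    have h2 : 2 * K % 2 = 0 := Nat.mul_mod_right 2 K
    have hpend := waves_pending hF d K ht hδ hway (2 * K)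
    have har : ∀ j, _ := fun j => waves_arrival_le hF d K ht hδ (i := 2 * K) j
    rw [h2, Nat.mul_div_cancel_left K two_pos, add_zero] at hpend
    simp only [h2, Nat.mul_div_cancel_left K two_pos, add_zero] at har
    rw [if_neg (by omega)] at hway
    refine (Plan.Optimal.heads_left hs hd le_rfl (fun j hj => (har j).2 hj) ?_
      (waves_optimal hF d K ht hδ hP hpend hway.cart)).2
    rw [hway.dist_left, hway.dist_right]
    linarith
  | succ m ih =>
    intro i s h1 hi hway h
    rw [List.range'_succ, List.range'_succ] at h
    obtain ⟨P, hP, s', hex, h⟩ := h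
    refine ih (i + 1) s' (by omega) (by omega) ?_ (by rw [List.range'_succ]; exact h)
    have hτ : waveTime t₀ δ (i + 1) - waveTime t₀ δ i = δ := by
      rw [waveTime, waveTime, if_neg (by omega), if_neg (by omega)]
      push_cast
      ring
    rw [hτ] at hex
    have hpend := waves_pending hF d K ht hδ hway i
    have har : ∀ j, _ := fun j => waves_arrival_le hF d K ht hδ (i := i) j
    have hopt := waves_optimal hF d K ht hδ hP hpend hway.cart
    -- For even `i` the new orders form whole groups and the picker, at distance ε from `v`, turns
    -- to `u`. For odd `i` one order is left over and she, at distance δ + ε, turns to `v`.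
    rcases Nat.mod_two_eq_zero_or_one i with h2 | h2
    · rw [h2, add_zero] at hopt
      simp only [h2, add_zero] at har
      rw [if_neg (by omega)] at hway
      obtain ⟨⟨x, l, hx, htar⟩, -⟩ := hopt.heads_left hs hd (by omega) (fun j hj => (har j).2 hj)
        (by rw [hway.dist_left, hway.dist_right]; linarith)
      rw [hx] at hex
      obtain ⟨y, hy, h3, h4, rfl⟩ := hex.of_lt (by rw [htar, hway.dist_left]; linarith)
      rw [htar, hway.dist_left] at h4
      rw [if_pos (by omega)]
      -- The path taken is unknown, but two triangle inequalities, via the old position and between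
      -- `u` and `v`, fix the new distance from `v`.
      have h5 := dist_triangle hy hway.pos_mem hs.right_mem
      have h6 := dist_triangle hs.left_mem hy hs.right_mem
      rw [Layout.dist_comm y s.pos, hway.dist_right, h3] at h5
      rw [Layout.dist_comm u y] at h6
      exact ⟨hy, by simp only; linarith, by simp only; linarith, hway.picked, hway.cart⟩
    · rw [h2] at hopt
      simp only [h2] at har
      rw [if_pos h2] at hway
      obtain ⟨x, l, hx, htar⟩ := hopt.heads_right hs hd (by omega) (fun j hj => (har j).2 hj)
        (by rw [hway.dist_left, hway.dist_right]; linarith)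
      rw [hx] at hex
      obtain ⟨y, hy, h3, h4, rfl⟩ := hex.of_lt (by rw [htar, hway.dist_right]; linarith)
      rw [htar, hway.dist_right] at h4
      rw [if_neg (by omega)]
      have h5 := dist_triangle hy hway.pos_mem hs.left_mem
      have h6 := dist_triangle hs.left_mem hy hs.right_mem
      rw [Layout.dist_comm y s.pos, hway.dist_left, h3] at h5
      rw [Layout.dist_comm u y] at h6
      exact ⟨hy, by simp only; linarith, by simp only; linarith, hway.picked, hway.cart⟩

/-- `t₀` is the moment at which the picker, having served `v`, is at distance δ + ε from it on her
way to `u`; this starts the oscillation. -/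
theorem waves_reopt (hs : IsShuttle κ w u v) (hd : 1 ≤ d) (hK : 1 ≤ K) (hε : 0 < ε)
    (hδε : δ + 2 * ε = batchTime κ (w.dist u v) / 2) (ht₀ : t₀ = w.dist w.depot v + (δ + ε)) {z : ℝ}
    (h : (waves hF d K ht hδ).ReoptFrom κ (d + 1) (waves hF d K ht hδ).arrivalTimes
      (waves hF d K ht hδ).init z) :
    waveTime t₀ δ (2 * K) + batchTime κ (w.dist u v) * K ≤ z := by
  have hlam : batchTime κ (w.dist u v) / 2 ≤ w.dist u v := by
    have := hs.dist_pos
    cases κ <;> simp only [batchTime] <;> linarith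
  rw [waves_arrivalTimes hF d K ht hδ hd, show 2 * K + 1 = 2 * K - 1 + 1 + 1 by omega,
    List.range'_succ, List.range'_succ] at h
  obtain ⟨P, hP, s', hex, h⟩ := h
  refine waves_reoptFrom hF d K ht hδ hs hd hε hδε (2 * K - 1) 1 s' le_rfl (by omega) ?_
    (by rw [List.range'_succ]; exact h)
  have hT0 : waveTime t₀ δ 0 = 0 := rfl
  have hτ : waveTime t₀ δ (0 + 1 * 1) - waveTime t₀ δ 0 = w.dist w.depot v + (δ + ε) := by
    simp [waveTime, ht₀]
  rw [hτ] at hex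
  have hpend : (waves hF d K ht hδ).arrived (waveTime t₀ δ 0) \ (waves hF d K ht hδ).init.picked =
      pendingItems κ u v (firstOrders _ d) ∅ := by
    rw [waves_arrived]
    simp [Instance.init, pendingItems]
  have hopt := waves_optimal hF d K ht hδ hP hpend (C := ∅) rfl
  rw [hT0] at hopt
  obtain ⟨L, x, l, hx, hLne, hL, htar⟩ := hopt.start hs hd fun j hj => by
    have := (waves_arrival_le hF d K ht hδ (i := 0) j).2 (by simpa using hj)
    rwa [hT0] at this
  rw [hx] at hex
  obtain ⟨y, hy, h1, h2, rfl⟩ := Instance.Exec.visit hs.right_mem htar (σ := δ + ε)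
    (by linarith) (by rw [Layout.dist_comm v u]; linarith) (fun y hy => ((hL y).1 hy).2) hLne hex
  rw [Layout.dist_comm v u] at h2
  refine ⟨hy, ?_, h2, ?_, ?_⟩
  · simpa [Layout.dist_comm y v] using h1
  · ext y
    simp only [Instance.init, Finset.empty_union, List.mem_toFinset, Finset.mem_product,
      Finset.mem_singleton]
    exact hL y
  · ext j
    simp only [Instance.init, Finset.empty_union]
    rw [mem_ordersOf]
    exact ⟨fun ⟨y, hy⟩ => ((hL _).1 hy).1, fun hj => ⟨v, (hL _).2 ⟨hj, rfl⟩⟩⟩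

end

/-! ### The competitive ratio -/

theorem ciopt_nonneg {w : Warehouse} (I : Instance w) (κ : Cart) (c : ℕ) : 0 ≤ I.ciopt κ c := by
  refine Real.sInf_nonneg ?_
  rintro _ ⟨P, -, rfl⟩
  exact le_finishTime _ _

theorem two_le_asympRatio {κ : Cart} {w : Warehouse} {u v : Point} (hs : IsShuttle κ w u v)
    (hF : ↑(stops κ u v) ⊆ w.pickingLocations) {c : ℕ} (hc : 2 ≤ c) {R : Instance w → ℝ}
    (hR : IsReopt κ w c R) : 2 ≤ asympRatio κ w c R := by
  obtain ⟨d, rfl⟩ : ∃ d, c = d + 1 := ⟨c - 1, by omega⟩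
  have hd : 1 ≤ d := by omega
  refine le_sInf ?_
  rintro _ ⟨α, ⟨M, hM⟩, rfl⟩
  suffices h : (2 : ℝ) ≤ α by
    change ((2 : ℝ) : EReal) ≤ (α : EReal)
    exact_mod_cast h
  by_contra! hα
  set lam := batchTime κ (w.dist u v) with hlam
  have hl : 0 < lam := batchTime_pos hs
  -- An upper bound on the optimum can be multiplied only by a nonnegative factor, and α might be
  -- negative.
  set a := max α 0 with ha
  have ha0 : 0 ≤ a := le_max_right _ _
  have ha2 : a < 2 := max_lt hα two_pos
  -- The loss per round is 4ε = λ(2 - a)/4, so the excess over `a` times the optimum grows by 3λ(2 -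
  -- a)/4 per round. The choice of `K` needs only λ(2 - a)/2. As a ≥ 0, also ε ≤ λ/8, which keeps δ
  -- positive.
  set ε := lam * (2 - a) / 16 with hεdef
  have hε : 0 < ε := by have : 0 < 2 - a := by linarith
                        positivity
  have hε' : ε ≤ lam / 8 := by rw [hεdef]; nlinarith
  set δ := lam / 2 - 2 * ε with hδdef
  have hδ : 0 < δ := by linarith
  have hd0 := dist_nonneg (w := w.toLayout) w.depot v
  have ht : 0 < w.dist w.depot v + (δ + ε) := by linarith
  set X := lam + (w.dist w.depot v + w.dist u v) with hX
  obtain ⟨K, hK⟩ := exists_nat_gt ((a * X + M + δ) / (lam * (2 - a) / 2))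
  have hden : 0 < lam * (2 - a) / 2 := by
    have : 0 < 2 - a := by linarith
    positivity
  rw [div_lt_iff₀ hden] at hK
  have hK0 : (K : ℝ) ≤ ((K + 1 : ℕ) : ℝ) := by push_cast; linarith
  have hK1 : a * X + M + δ < ((K + 1 : ℕ) : ℝ) * (lam * (2 - a) / 2) :=
    hK.trans_le (mul_le_mul_of_nonneg_right hK0 hden.le)
  set N := K + 1 with hN
  have h1 := hM (waves hF d N ht hδ)
  have h2 := waves_reopt hF d N ht hδ hs hd (by omega) hε (by rw [hδdef]; ring) rfl
    (hR (waves hF d N ht hδ))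
  have h3 := waves_ciopt_le hF d N ht hδ hs hd (by linarith) (by linarith)
  have h4 : α * (waves hF d N ht hδ).ciopt κ (d + 1) ≤ a * (X + lam * N) :=
    (mul_le_mul_of_nonneg_right (le_max_left _ _) (ciopt_nonneg _ _ _)).trans
      (mul_le_mul_of_nonneg_left h3 ha0)
  rw [waveTime, if_neg (by omega)] at h2
  push_cast [← hlam] at h2
  have e1 : δ * N = lam * N / 2 - lam * N * (2 - a) / 8 := by
    rw [hδdef, hεdef]; ring
  have h5 : w.dist w.depot v + (δ + ε) + (2 * (N : ℝ) - 1) * δ + lam * N ≤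
      a * (X + lam * N) + M := by linarith
  nlinarith

end OrderPicking

end

theorem proposition3 (w : OrderPicking.Warehouse) (c : ℕ) (hc : 2 ≤ c) :
    (2 ≤ w.a → ∀ R : OrderPicking.Instance w → ℝ,
      OrderPicking.IsReopt OrderPicking.Cart.pushcart w c R →
        2 ≤ OrderPicking.asympRatio OrderPicking.Cart.pushcart w c R) ∧
    (∀ R : OrderPicking.Instance w → ℝ,
      OrderPicking.IsReopt OrderPicking.Cart.robot w c R →
        2 ≤ OrderPicking.asympRatio OrderPicking.Cart.robot w c R) := by
  obtain ⟨u, hu, v, hv, h1, h2⟩ := OrderPicking.Layout.exists_closer w.depot_mem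
  have hu' := OrderPicking.Layout.floor_of_pickingLocations hu
  have hv' := OrderPicking.Layout.floor_of_pickingLocations hv
  refine ⟨fun _ R hR => ?_, fun R hR => ?_⟩
  -- The farther location serves as the right end point; being farther from the depot than another
  -- point, it has positive distance from it.
  · refine OrderPicking.two_le_asympRatio (u := w.depot) (v := u)
      ⟨w.depot_mem, hu', (OrderPicking.Layout.dist_nonneg _ _).trans_lt h2, fun _ => rfl,
        fun h => by cases h⟩ ?_ hc hR
    simpa [OrderPicking.stops] using hu
  · refine OrderPicking.two_le_asympRatio (u := u) (v := v)
      ⟨hu', hv', h1, fun h => (by cases h), fun _ => h2⟩ ?_ hc hR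
    simp [OrderPicking.stops, Set.insert_subset_iff, hu, hv]
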